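/- Let $p\ge 0$ be an integer and let $\rho:\mathbb{Z}^p\times\mathbb{Z}^p\to\mathbb{T}$ be an antisymmetric bicharacter. Put $\rho_{ij}=\rho(e_i,e_j)$ and let $A_\rho$ be the noncommutative $p$-torus, i.e. the universal unital $C^*$-algebra generated by unitaries $u_1,\dots,u_p$ with $u_ju_i=\rho_{ij}u_iu_j$. Let $\gamma$ be the action of $(\mathbb{R}/\mathbb{Z})^p$ on $A_\rho$ by $^*$-automorphisms with $\gamma_t(u_j)=e^{2\pi i t_j}u_j$, let $\ell(t)$ be $2\pi$ times the distance from $t$ to $0$ in the metric on $(\mathbb{R}/\mathbb{Z})^p$ induced by the Euclidean metric of $\mathbb{R}^p$, and set $$L(a)=\sup_{t\ne 0}\frac{\|\gamma_t(a)-a\|}{\ell(t)}\in[0,\infty],\qquad a\in A_\rho .$$ For a set $Z\subseteq A_\rho$ and $\delta>0$ let $D(Z,\delta)$ be the least dimension of a finite-dimensional linear subspace $X\subseteq A_\rho$ such that every $z\in Z$ satisfies $\|z-x\|<\delta$ for some $x\in X$ (and $D(Z,\delta)=\infty$ if there is none). For a $^*$-automorphism $\alpha$ of $A_\rho$ define the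 product entropy $$\mathrm{Entp}_L(\alpha)=\sup_{\Omega}\,\sup_{\delta>0}\,\limsup_{n\to\infty}\frac1n\log D\big(\Omega\cdot\alpha(\Omega)\cdots\alpha^{n-1}(\Omega),\delta\big),$$ where $\Omega$ runs over the finite subsets of $\{a\in A_\rho: L(a)<\infty,\ \|a\|\le 1\}$ and $\Omega\cdot\alpha(\Omega)\cdots\alpha^{n-1}(\Omega)=\{a_0\,\alpha(a_1)\cdots\alpha^{n-1}(a_{n-1}) : a_0,\dots,a_{n-1}\in\Omega\}$ (with $\log 0=-\infty$). Let $T=(s_{ij})$ be a $p\times p$ integer matrix with $\det T=\pm1$, and suppose that there is a $^*$-automorphism $\alpha_T$ of $A_\rho$ with $\alpha_T(u_j)=u_1^{s_{1j}}\cdots u_p^{s_{pj}}$ for $j=1,\dots,p$. Let $t\in(\mathbb{R}/\mathbb{Z})^p$, and let $u\in A_\rho$ be a unitary with $L(u)<\infty$; write $(\mathrm{Ad}\,u)(a)=uau^*$. Then $$\mathrm{Entp}_L(\mathrm{Ad}\,u\circ\alpha_T\circ\gamma_t)\ \le\ \sum_{|\lambda_i|\ge 1}\log|\lambda_i| ,$$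 where $\lambda_1,\dots,\lambda_p\in\mathbb{C}$ are the eigenvalues of $T$ counted with algebraic multiplicity. -/

import Mathlib

open scoped ENNReal

noncomputable section

/-! ### Approximation dimension and product entropy in a unital C*-algebra -/

/-- `Z` approximately contains `Y` to within `δ`: every `y ∈ Y` has norm distance less than `δ`
to some element of `Z`. -/
def ApproxContains {X : Type*} [NormedAddCommGroup X] (Z Y : Set X) (δ : ℝ) : Prop :=
  ∀ y ∈ Y, ∃ x ∈ Z, ‖y - x‖ < δ

/-- `D(Z, δ)`: the least dimension of a finite-dimensional linear subspace which approximately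
contains `Z` to within `δ`, and `⊤` if there is no such subspace. -/
def approxDim {A : Type*} [CStarAlgebra A] (Z : Set A) (δ : ℝ) : ℕ∞ :=
  ⨅ (X : Submodule ℂ A) (_ : FiniteDimensional ℂ X) (_ : ApproxContains (X : Set A) Z δ),
    (Module.finrank ℂ X : ℕ∞)

/-- The set `Ω · α(Ω) · α²(Ω) ⋯ αⁿ⁻¹(Ω)` of ordered products. -/
def orbitProduct {A : Type*} [CStarAlgebra A] (α : A ≃⋆ₐ[ℂ] A) (Ω : Set A) (n : ℕ) : Set A :=
  {x | ∃ a : Fin n → A, (∀ j, a j ∈ Ω) ∧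
    x = (List.ofFn fun j : Fin n => (α : A → A)^[(j : ℕ)] (a j)).prod}

/-- `Entp(α, Ω, δ) = limsup_n (1/n) log D(Ω · α(Ω) ⋯ αⁿ⁻¹(Ω), δ)`, as an extended real. -/
def entpAt {A : Type*} [CStarAlgebra A] (α : A ≃⋆ₐ[ℂ] A) (Ω : Set A) (δ : ℝ) : EReal :=
  Filter.limsup
    (fun n : ℕ => (((n : ℝ)⁻¹ : ℝ) : EReal) *
      ENNReal.log ((approxDim (orbitProduct α Ω n) δ : ℕ∞) : ℝ≥0∞))
    Filter.atTop

/-- The product entropy `Entp_L(α)`: the supremum of `Entp(α, Ω, δ)` over all `δ > 0` and all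
finite subsets `Ω` of `{a : L(a) < ∞, ‖a‖ ≤ 1}`. -/
def productEntropy {A : Type*} [CStarAlgebra A] (L : A → ℝ≥0∞) (α : A ≃⋆ₐ[ℂ] A) : EReal :=
  ⨆ (Ω : Finset A) (_ : ∀ a ∈ Ω, L a < ⊤ ∧ ‖a‖ ≤ 1) (δ : ℝ) (_ : 0 < δ),
    entpAt α (Ω : Set A) δ

/-! ### Noncommutative tori -/

/-- An antisymmetric bicharacter on `ℤᵖ` with values in the unit circle. -/
structure AntisymmBichar (p : ℕ) where
  toFun : (Fin p → ℤ) → (Fin p → ℤ) → Circle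
  add_left : ∀ g h k, toFun (g + h) k = toFun g k * toFun h k
  add_right : ∀ g h k, toFun g (h + k) = toFun g h * toFun g k
  antisymm : ∀ g h, toFun h g = (toFun g h)⁻¹

namespace AntisymmBichar

/-- The entry `ρ_ij = ρ(e_i, e_j)`. -/
def entry {p : ℕ} (ρ : AntisymmBichar p) (i j : Fin p) : Circle :=
  ρ.toFun (Pi.single i 1) (Pi.single j 1)

end AntisymmBichar

/-- A representation of the defining relations of the noncommutative torus: a nonzero unital
C*-algebra together with unitaries `v_1, …, v_p` such that `v_j v_i = ρ_ij v_i v_j`. -/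
structure TorusRep {p : ℕ} (ρ : AntisymmBichar p) : Type 1 where
  carrier : Type
  [cstar : CStarAlgebra carrier]
  [nontriv : Nontrivial carrier]
  v : Fin p → unitary carrier
  rel : ∀ i j, (v j : carrier) * v i = (ρ.entry i j : ℂ) • ((v i : carrier) * v j)

namespace TorusRep

variable {p : ℕ} {ρ : AntisymmBichar p}

instance (i : TorusRep ρ) : CStarAlgebra i.carrier := i.cstar

instance (i : TorusRep ρ) : Nontrivial i.carrier := i.nontriv

/-- The representation obtained by multiplying the unitaries `v_j` by phases `z_j`. -/
def twist (z : Fin p → Circle) (i : TorusRep ρ) : TorusRep ρ where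
  carrier := i.carrier
  v j := ⟨(z j : ℂ) • (i.v j : i.carrier), by
    have h : star (z j : ℂ) * (z j : ℂ) = 1 := by
      simp [← Circle.coe_inv_eq_conj]
    have h' : (z j : ℂ) * star (z j : ℂ) = 1 := by rw [mul_comm, h]
    rw [Unitary.mem_iff, star_smul, smul_mul_smul_comm, smul_mul_smul_comm, h, h',
      one_smul, one_smul]
    exact ⟨Unitary.coe_star_mul_self _, Unitary.coe_mul_star_self _⟩⟩
  rel a b := by
    simp only [smul_mul_smul_comm]
    rw [i.rel a b, smul_smul, smul_smul]
    congr 1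
    ring

end TorusRep

/-- The C*-algebra of all bounded families indexed by the representations of the relations
(the `ℓ^∞`-product of all their C*-algebras). -/
abbrev TorusProd {p : ℕ} (ρ : AntisymmBichar p) : Type 1 :=
  lp (fun i : TorusRep ρ => i.carrier) ∞

instance {p : ℕ} (ρ : AntisymmBichar p) : CStarAlgebra (TorusProd ρ) where

namespace TorusProd

variable {p : ℕ} (ρ : AntisymmBichar p)

/-- The `j`-th universal unitary, whose component in each representation is `v_j`. -/
def gen (j : Fin p) : unitary (TorusProd ρ) :=
  ⟨⟨fun i => (i.v j : i.carrier), memℓp_infty ⟨1, by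
      rintro _ ⟨i, rfl⟩
      exact (CStarRing.norm_coe_unitary (i.v j)).le⟩⟩, by
    rw [Unitary.mem_iff]
    constructor
    · ext i
      exact Unitary.coe_star_mul_self (i.v j)
    · ext i
      exact Unitary.coe_mul_star_self (i.v j)⟩

/-- The *-endomorphism of the product which permutes the factors by `TorusRep.twist z`. -/
def rot (z : Fin p → Circle) : TorusProd ρ →⋆ₐ[ℂ] TorusProd ρ where
  toFun x := ⟨fun i => x (i.twist z), memℓp_infty ⟨‖x‖, by
    rintro _ ⟨i, rfl⟩
    exact lp.norm_apply_le_norm ENNReal.top_ne_zero x (i.twist z)⟩⟩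
  map_one' := rfl
  map_mul' _ _ := rfl
  map_zero' := rfl
  map_add' _ _ := rfl
  commutes' _ := rfl
  map_star' _ := rfl

end TorusProd

/-- The noncommutative torus `A_ρ`, i.e. the universal C*-algebra generated by unitaries
`u_1, …, u_p` with `u_j u_i = ρ_ij u_i u_j`: the C*-subalgebra generated by the universal
unitaries inside the product over all representations of these relations. -/
def torusSubalgebra {p : ℕ} (ρ : AntisymmBichar p) : StarSubalgebra ℂ (TorusProd ρ) :=
  (StarAlgebra.adjoin ℂ (Set.range fun j => (TorusProd.gen ρ j : TorusProd ρ))).topologicalClosure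

/-- The noncommutative torus `A_ρ` as a type. -/
def NCTorus {p : ℕ} (ρ : AntisymmBichar p) : Type 1 := torusSubalgebra ρ

instance {p : ℕ} (ρ : AntisymmBichar p) : CStarAlgebra (NCTorus ρ) :=
  StarSubalgebra.cstarAlgebra (torusSubalgebra ρ)
    (h_closed := StarSubalgebra.isClosed_topologicalClosure _)

namespace NCTorus

variable {p : ℕ} (ρ : AntisymmBichar p)

/-- The inclusion of `A_ρ` into the product over all representations. -/
def incl : NCTorus ρ →⋆ₐ[ℂ] TorusProd ρ where
  toFun x := Subtype.val x
  map_one' := rfl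
  map_mul' _ _ := rfl
  map_zero' := rfl
  map_add' _ _ := rfl
  commutes' _ := rfl
  map_star' _ := rfl

theorem norm_incl (x : NCTorus ρ) : ‖incl ρ x‖ = ‖x‖ := rfl

/-- An element of `A_ρ` from an element of the product lying in the generated subalgebra. -/
def mk (x : TorusProd ρ) (hx : x ∈ torusSubalgebra ρ) : NCTorus ρ := Subtype.mk x hx

theorem incl_mem (x : NCTorus ρ) : incl ρ x ∈ torusSubalgebra ρ := Subtype.property x

theorem incl_injective : Function.Injective (incl ρ) := Subtype.val_injective

/-- The canonical generators `u_1, …, u_p` of `A_ρ`. -/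
def u (j : Fin p) : unitary (NCTorus ρ) :=
  ⟨mk ρ (TorusProd.gen ρ j) (StarSubalgebra.le_topologicalClosure _
      (StarAlgebra.subset_adjoin ℂ _ ⟨j, rfl⟩)),
    Unitary.mem_iff.2
      ⟨incl_injective ρ (Unitary.coe_star_mul_self (TorusProd.gen ρ j)),
        incl_injective ρ (Unitary.coe_mul_star_self (TorusProd.gen ρ j))⟩⟩

theorem u_mul_u (i j : Fin p) :
    (u ρ j : NCTorus ρ) * u ρ i = (ρ.entry i j : ℂ) • ((u ρ i : NCTorus ρ) * u ρ j) := by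
  apply incl_injective ρ
  apply lp.ext
  funext r
  exact r.rel i j

/-- Universality: unitaries in a unital C*-algebra satisfying the relations are the images of the
canonical generators under a unital *-homomorphism. -/
theorem exists_lift {B : Type} [CStarAlgebra B] (v : Fin p → unitary B)
    (hv : ∀ i j, (v j : B) * v i = (ρ.entry i j : ℂ) • ((v i : B) * v j)) :
    ∃ f : NCTorus ρ →⋆ₐ[ℂ] B, ∀ j, f (u ρ j) = v j := by
  rcases subsingleton_or_nontrivial B with hB | hB
  · exact ⟨{ toFun := fun _ => 0
             map_one' := Subsingleton.elim _ _
             map_mul' := fun _ _ => Subsingleton.elim _ _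
             map_zero' := rfl
             map_add' := fun _ _ => Subsingleton.elim _ _
             commutes' := fun _ => Subsingleton.elim _ _
             map_star' := fun _ => Subsingleton.elim _ _ }, fun _ => Subsingleton.elim _ _⟩
  · exact ⟨{ toFun := fun x => incl ρ x ⟨B, v, hv⟩
             map_one' := rfl
             map_mul' := fun _ _ => rfl
             map_zero' := rfl
             map_add' := fun _ _ => rfl
             commutes' := fun _ => rfl
             map_star' := fun _ => rfl }, fun _ => rfl⟩

theorem rot_mem (z : Fin p → Circle) (x : TorusProd ρ) (hx : x ∈ torusSubalgebra ρ) :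
    TorusProd.rot ρ z x ∈ torusSubalgebra ρ := by
  have hcont : Continuous (TorusProd.rot ρ z) := by
    refine AddMonoidHomClass.continuous_of_bound (TorusProd.rot ρ z) 1 fun y => ?_
    rw [one_mul]
    exact lp.norm_le_of_forall_le (norm_nonneg y) fun i =>
      lp.norm_apply_le_norm ENNReal.top_ne_zero y (i.twist z)
  have hle : torusSubalgebra ρ ≤ (torusSubalgebra ρ).comap (TorusProd.rot ρ z) := by
    refine StarSubalgebra.topologicalClosure_minimal (StarAlgebra.adjoin_le ?_) ?_
    · rintro _ ⟨j, rfl⟩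
      have h : TorusProd.rot ρ z (TorusProd.gen ρ j) = (z j : ℂ) • (TorusProd.gen ρ j : TorusProd ρ) :=
        rfl
      change TorusProd.rot ρ z (TorusProd.gen ρ j) ∈ torusSubalgebra ρ
      rw [h]
      exact (torusSubalgebra ρ).smul_mem (StarSubalgebra.le_topologicalClosure _
        (StarAlgebra.subset_adjoin ℂ _ ⟨j, rfl⟩)) _
    · exact (StarSubalgebra.isClosed_topologicalClosure _).preimage hcont
  exact hle hx

theorem twist_twist (z w : Fin p → Circle) (h : ∀ j, z j * w j = 1) (i : TorusRep ρ) :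
    (i.twist z).twist w = i := by
  obtain ⟨B, v, hv⟩ := i
  simp only [TorusRep.twist]
  congr
  funext j
  apply Subtype.ext
  have : (w j : ℂ) * (z j : ℂ) = 1 := by
    rw [mul_comm, ← Circle.coe_mul, h, Circle.coe_one]
  change (w j : ℂ) • (z j : ℂ) • (v j : B) = v j
  rw [smul_smul, this, one_smul]

theorem rot_rot (z w : Fin p → Circle) (h : ∀ j, z j * w j = 1) (x : TorusProd ρ) :
    TorusProd.rot ρ z (TorusProd.rot ρ w x) = x := by
  apply lp.ext
  funext i
  have key : ∀ k : TorusRep ρ, k = i → HEq (x k) (x i) := by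
    rintro k rfl
    rfl
  exact eq_of_heq (key _ (twist_twist ρ z w h i))

/-- The canonical action `γ` of `𝕋ᵖ = (ℝ/ℤ)ᵖ` on `A_ρ`: `γ_t` permutes the representations by
multiplying `v_j` by `exp(2πi t_j)`; it is determined by `γ_t(u_j) = exp(2πi t_j) u_j`. -/
def γ (t : Fin p → UnitAddCircle) : NCTorus ρ ≃⋆ₐ[ℂ] NCTorus ρ where
  toFun x := mk ρ (TorusProd.rot ρ (fun j => (t j).toCircle) (incl ρ x)) (rot_mem ρ _ _ (incl_mem ρ x))
  invFun x := mk ρ (TorusProd.rot ρ (fun j => (-t j).toCircle) (incl ρ x)) (rot_mem ρ _ _ (incl_mem ρ x))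
  left_inv x := incl_injective ρ (rot_rot ρ _ _ (fun j => by
    rw [← AddCircle.toCircle_add, neg_add_cancel, AddCircle.toCircle_zero]) (incl ρ x))
  right_inv x := incl_injective ρ (rot_rot ρ _ _ (fun j => by
    rw [← AddCircle.toCircle_add, add_neg_cancel, AddCircle.toCircle_zero]) (incl ρ x))
  map_mul' _ _ := rfl
  map_add' _ _ := rfl
  map_star' _ := rfl
  map_smul' _ _ := rfl

theorem γ_u (t : Fin p → UnitAddCircle) (j : Fin p) :
    γ ρ t (u ρ j) = ((t j).toCircle : ℂ) • (u ρ j : NCTorus ρ) := rfl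

/-- The length function on `𝕋ᵖ`: the distance to `0` in the metric induced from the Euclidean
metric of `ℝᵖ` scaled by `2π` (here `‖t_j‖` is the distance from `t_j` to the nearest integer). -/
def length (t : Fin p → UnitAddCircle) : ℝ :=
  2 * Real.pi * Real.sqrt (∑ j, ‖t j‖ ^ 2)

/-- The canonical seminorm `L(a) = sup_{t ≠ 0} ‖γ_t(a) - a‖ / ℓ(t)` on `A_ρ`, with values in
`[0, ∞]`. -/
def L (a : NCTorus ρ) : ℝ≥0∞ :=
  ⨆ (t : Fin p → UnitAddCircle) (_ : t ≠ 0), ENNReal.ofReal (‖γ ρ t a - a‖ / length t)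

end NCTorus

open scoped Classical in
/-- `∑_{|λ_i| ≥ 1} log |λ_i|`, where `λ_1, …, λ_p` are the complex eigenvalues of the integer
matrix `T` counted with (algebraic) multiplicity. -/
def sumLogEigenvalues {p : ℕ} (T : Matrix (Fin p) (Fin p) ℤ) : ℝ :=
  (((T.map (Int.cast : ℤ → ℂ)).charpoly.roots.filter fun z => 1 ≤ ‖z‖).map
    fun z => Real.log ‖z‖).sum

end

noncomputable section

/-! ### Generalized eigenvectors of a complex matrix and growth of orbits -/

/-! Write `β = α_T ∘ γ_t`. Up to phases, `β` sends the monomial with exponent `g` to the one with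
exponent `T g`, and monomials multiply by adding exponents. Hence, if `y_k` are polynomials with
exponents in the box of radius `N`, the product `y_0 β(y_1) ⋯ β^{n-1}(y_{n-1})` lies in the span of
the monomials with exponents in the sumset `∑_{k<n} T^k(box)`, and the dimension is bounded by the
number of lattice points of that sumset.

Counting: pair the sumset with generalized eigenvectors of the transpose of `T`. The `i`-th pairing
is at most polynomial(`N`, `n`) times `max(1, |λ_i|)^n`, so there are at most polynomial times `(∏
max(1, |λ_i|))^n` points (`exists_ncard_orbitSumset_le`).

Approximation: the `n` factors must each be approximated to within a multiple of `1/n`, so the box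
has to grow with `n`. Finiteness of `L` is what keeps this growth polynomial: Fejér averaging of the
torus action gives error `O(1/R)` with exponents bounded by `R^2`
(`NCTorus.exists_polySpan_box_approx`). Polynomial factors disappear under `(1/n) log`.

The inner perturbation: an ordered product along the orbit of `Ad u ∘ β` is the product of the
`β^k(a_k u)` times a unitary depending only on `n` (`seqProd_iterate_trans_conj`). Right
multiplication by a fixed element does not raise dimension, so it suffices to approximate the
elements `a u`, which are again Lipschitz. -/

theorem exists_basis_maxGenEigenspace {V ι : Type*} [AddCommGroup V] [Module ℂ V]
    [FiniteDimensional ℂ V] [Fintype ι] (hι : Fintype.card ι = Module.finrank ℂ V)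
    (f : Module.End ℂ V) :
    ∃ (b : Module.Basis ι ℂ V) (μ : ι → ℂ), (∀ i, b i ∈ f.maxGenEigenspace (μ i)) ∧
      Finset.univ.val.map μ = f.charpoly.roots := by
  classical
  have hint : DirectSum.IsInternal fun μ : ℂ => f.maxGenEigenspace μ :=
    DirectSum.isInternal_submodule_of_iSupIndep_of_iSup_eq_top f.independent_maxGenEigenspace
      f.iSup_maxGenEigenspace_eq_top
  let b := hint.collectedBasis fun μ => Module.finBasis ℂ (f.maxGenEigenspace μ)
  have : Fintype (Σ μ : ℂ, Fin (Module.finrank ℂ (f.maxGenEigenspace μ))) :=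
    @Fintype.ofFinite _ (Module.Finite.finite_basis b)
  have hcard := (Module.finrank_eq_card_basis b).symm.trans hι.symm
  let e := Fintype.equivOfCardEq hcard
  refine ⟨b.reindex e, fun i => (e.symm i).1, fun i => ?_, ?_⟩
  · rw [Module.Basis.reindex_apply]
    exact hint.collectedBasis_mem _ _
  · ext μ
    rw [Polynomial.count_roots, ← LinearMap.finrank_maxGenEigenspace_eq, Multiset.count_map]
    have h1 : (Finset.univ.filter fun i => μ = (e.symm i).1).card =
        Module.finrank ℂ (f.maxGenEigenspace μ) := by
      rw [← Fintype.card_fin (Module.finrank ℂ (f.maxGenEigenspace μ)), ← Finset.card_univ]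
      symm
      refine Finset.card_bij (fun k _ => e ⟨μ, k⟩) (by simp) ?_ ?_
      · intro a _ c _ h
        simpa using h
      · intro i hi
        obtain ⟨x, rfl⟩ := e.surjective i
        obtain ⟨ν, k⟩ := x
        simp only [Finset.mem_filter, Finset.mem_univ, true_and, Equiv.symm_apply_apply] at hi
        subst hi
        exact ⟨k, by simp, rfl⟩
    exact h1

/-- Induction on the nilpotency order, through `f^(k+1) v = μ f^k v + f^k ((f - μ) v)`, whose last
term is of lower order. Replacing `‖μ‖` by `max 1 ‖μ‖` makes the powers monotone in `k`, which is
what lets the two terms merge; contracting directions cost only a polynomial factor. -/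
theorem exists_norm_pow_apply_le {V : Type*} [NormedAddCommGroup V] [NormedSpace ℂ V]
    (f : Module.End ℂ V) (μ : ℂ) (m : ℕ) (v : V)
    (hv : ((f - algebraMap ℂ (Module.End ℂ V) μ) ^ m) v = 0) :
    ∃ C : ℝ, 0 ≤ C ∧ ∀ k : ℕ, ‖(f ^ k) v‖ ≤ C * (k + 1) ^ m * max 1 ‖μ‖ ^ k := by
  induction m generalizing v with
  | zero =>
    refine ⟨0, le_rfl, fun k => ?_⟩
    have : v = 0 := by simpa using hv
    simp [this]
  | succ m ih =>
    obtain ⟨C, hC, h⟩ := ih ((f - algebraMap ℂ (Module.End ℂ V) μ) v) (by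
      rw [pow_succ] at hv
      exact hv)
    refine ⟨C + ‖v‖, by positivity, fun k => ?_⟩
    have hM : (1 : ℝ) ≤ max 1 ‖μ‖ := le_max_left _ _
    have hμ : ‖μ‖ ≤ max 1 ‖μ‖ := le_max_right _ _
    set M := max 1 ‖μ‖
    induction k with
    | zero => simpa using hC
    | succ k ihk =>
      have e : (f ^ (k + 1)) v =
          μ • (f ^ k) v + (f ^ k) ((f - algebraMap ℂ (Module.End ℂ V) μ) v) := by
        rw [LinearMap.sub_apply, map_sub, Module.algebraMap_end_apply, map_smul, pow_succ]
        simp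
      have hk : (0 : ℝ) ≤ k := Nat.cast_nonneg k
      calc ‖(f ^ (k + 1)) v‖
          ≤ ‖μ‖ * ‖(f ^ k) v‖ + ‖(f ^ k) ((f - algebraMap ℂ (Module.End ℂ V) μ) v)‖ := by
            rw [e, ← norm_smul]
            exact norm_add_le _ _
        _ ≤ M * ((C + ‖v‖) * (k + 1) ^ (m + 1) * M ^ k) + C * (k + 1) ^ m * M ^ k := by
            gcongr
            exact h k
        _ ≤ M * ((C + ‖v‖) * (k + 1) ^ (m + 1) * M ^ k) + (C + ‖v‖) * (k + 1) ^ m * M ^ (k + 1) := by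
            gcongr
            · exact le_add_of_nonneg_right (norm_nonneg v)
            omega
        _ = (C + ‖v‖) * ((k + 1) ^ m * (k + 2)) * M ^ (k + 1) := by ring
        _ ≤ (C + ‖v‖) * ((k + 1 + 1) ^ m * (k + 2)) * M ^ (k + 1) := by
            gcongr
            linarith
        _ = (C + ‖v‖) * (((k + 1 : ℕ) : ℝ) + 1) ^ (m + 1) * M ^ (k + 1) := by
            push_cast
            ring

/-! ### Counting lattice points -/

/-- By multilinearity in the rows `Re + i Im`, `det A` is a combination of the determinants obtained
by choosing the real or the imaginary part of each row; they cannot all vanish. This replaces `p`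
complex linear forms by `p` real ones that are no larger, so each eigenvalue is charged once and not
twice. -/
theorem exists_re_im_det_ne_zero {n : Type*} [Fintype n] [DecidableEq n] (A : Matrix n n ℂ)
    (hA : A.det ≠ 0) :
    ∃ B : Matrix n n ℝ, B.det ≠ 0 ∧
      ∀ i, (∀ j, B i j = (A i j).re) ∨ (∀ j, B i j = (A i j).im) := by
  by_contra! hcon
  apply hA
  let a : Matrix n n ℂ := fun i j => ((A i j).re : ℂ)
  let b : Matrix n n ℂ := fun i j => ((A i j).im : ℂ)
  have hsplit : A = fun i => a i + Complex.I • b i := by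
    funext i j
    simp [a, b, mul_comm Complex.I, Complex.re_add_im]
  have hexp := (Matrix.detRowAlternating (R := ℂ) (n := n)).toMultilinearMap.map_add_univ
    a (fun i => Complex.I • b i)
  change Matrix.detRowAlternating A = 0
  conv_lhs => rw [hsplit]
  refine hexp.trans (Finset.sum_eq_zero fun s _ => ?_)
  let B : Matrix n n ℝ := fun i j => if i ∈ s then (A i j).re else (A i j).im
  have hB : B.det = 0 := by
    by_contra h
    obtain ⟨i, hi⟩ := hcon B h
    by_cases his : i ∈ s
    · obtain ⟨j, hj⟩ := hi.1
      exact hj (by simp [B, his])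
    · obtain ⟨j, hj⟩ := hi.2
      exact hj (by simp [B, his])
  let BC : Matrix n n ℂ := fun i j => (B i j : ℂ)
  have hBC : ∀ i j, BC i j = if i ∈ s then ((A i j).re : ℂ) else ((A i j).im : ℂ) := by
    intro i j
    by_cases his : i ∈ s <;> simp [his, BC, B]
  have hrow : s.piecewise a (fun i => Complex.I • b i) =
      fun i => (if i ∈ s then (1 : ℂ) else Complex.I) • BC i := by
    funext i j
    by_cases his : i ∈ s <;> simp [his, a, b, hBC]
  rw [hrow]
  refine ((Matrix.detRowAlternating (R := ℂ) (n := n)).toMultilinearMap.map_smul_univ _ BC).trans ?_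
  have h0 : BC.det = 0 := by
    have := (RingHom.map_det (algebraMap ℝ ℂ) B).symm
    rw [hB, map_zero] at this
    exact this
  exact (congrArg _ h0).trans (smul_zero _)

/-- After a fixed dilation, rounding down the coordinates of `B x` is injective on the lattice, and
its values lie in an integer box. -/
theorem exists_ncard_le_prod {p : ℕ} (B : Matrix (Fin p) (Fin p) ℝ) (hB : B.det ≠ 0) :
    ∃ K : ℝ, 0 < K ∧ ∀ (r : Fin p → ℝ) (S : Set (Fin p → ℤ)), (∀ i, 1 ≤ r i) →
      (∀ x ∈ S, ∀ i, |B.mulVec (fun j => (x j : ℝ)) i| ≤ r i) →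
      S.Finite ∧ (S.ncard : ℝ) ≤ ∏ i, K * r i := by
  -- `C` exceeds every absolute row sum of `B⁻¹`, so equal floors of `C B x` and `C B y` force `|x_i
  -- - y_i| < 1`.
  set C : ℝ := 1 + ∑ i, ∑ j, |B⁻¹ i j| with hC
  have hCpos : 0 < C := by positivity
  refine ⟨2 * C + 2, by positivity, fun r S hr hS => ?_⟩
  let F : (Fin p → ℤ) → (Fin p → ℤ) := fun x i => ⌊C * B.mulVec (fun j => (x j : ℝ)) i⌋
  have hinj : Function.Injective F := by
    intro x y hxy
    set w : Fin p → ℝ := B.mulVec (fun j => (x j : ℝ)) - B.mulVec (fun j => (y j : ℝ)) with hw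
    have hwi : ∀ i, C * |w i| < 1 := fun i => by
      have := Int.abs_sub_lt_one_of_floor_eq_floor (congrFun hxy i)
      rwa [← mul_sub, abs_mul, abs_of_pos hCpos] at this
    have hinv : (fun j => ((x j : ℝ) - y j)) = B⁻¹.mulVec w := by
      rw [hw, ← Matrix.mulVec_sub, Matrix.mulVec_mulVec, Matrix.nonsing_inv_mul _ (by
        exact isUnit_iff_ne_zero.2 hB), Matrix.one_mulVec]
      rfl
    funext i
    have h1 : |(x i : ℝ) - y i| < 1 := by
      have : (x i : ℝ) - y i = ∑ j, B⁻¹ i j * w j := congrFun hinv i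
      rw [this]
      have hlt : ∀ j, |w j| ≤ 1 / C := fun j => by
        rw [le_div_iff₀ hCpos, mul_comm]
        exact (hwi j).le
      calc |∑ j, B⁻¹ i j * w j| ≤ ∑ j, |B⁻¹ i j| * (1 / C) := by
            refine (Finset.abs_sum_le_sum_abs _ _).trans (Finset.sum_le_sum fun j _ => ?_)
            rw [abs_mul]
            exact mul_le_mul_of_nonneg_left (hlt j) (abs_nonneg _)
        _ = (∑ j, |B⁻¹ i j|) / C := by rw [← Finset.sum_mul, mul_one_div]
        _ < 1 := by
            rw [div_lt_one hCpos, hC]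
            have : ∑ j, |B⁻¹ i j| ≤ ∑ i, ∑ j, |B⁻¹ i j| :=
              Finset.single_le_sum (f := fun i => ∑ j, |B⁻¹ i j|)
                (fun i _ => by positivity) (Finset.mem_univ i)
            linarith
    have h2 : |x i - y i| < 1 := by exact_mod_cast h1
    have := Int.abs_lt_one_iff.1 h2
    omega
  have hmaps : ∀ x ∈ S, F x ∈
      Fintype.piFinset fun i => Finset.Icc (⌊-(C * r i)⌋) ⌊C * r i⌋ := by
    intro x hx
    rw [Fintype.mem_piFinset]
    intro i
    have h := abs_le.1 (hS x hx i)
    rw [Finset.mem_Icc]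
    constructor
    · apply Int.floor_le_floor
      rw [← mul_neg]
      exact mul_le_mul_of_nonneg_left h.1 hCpos.le
    · exact Int.floor_le_floor (mul_le_mul_of_nonneg_left h.2 hCpos.le)
  have hfin : S.Finite := Set.Finite.of_finite_image
    ((Finset.finite_toSet _).subset (Set.image_subset_iff.2 hmaps)) hinj.injOn
  refine ⟨hfin, ?_⟩
  have hle : S.ncard ≤ (Fintype.piFinset fun i => Finset.Icc (⌊-(C * r i)⌋) ⌊C * r i⌋).card := by
    rw [← Set.ncard_coe_finset]
    exact Set.ncard_le_ncard_of_injOn F hmaps hinj.injOn (Finset.finite_toSet _)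
  calc (S.ncard : ℝ) ≤ ((Fintype.piFinset fun i =>
        Finset.Icc (⌊-(C * r i)⌋) ⌊C * r i⌋).card : ℝ) := by exact_mod_cast hle
    _ = ∏ i, ((Finset.Icc (⌊-(C * r i)⌋) ⌊C * r i⌋).card : ℝ) := by
        rw [Fintype.card_piFinset]
        push_cast
        rfl
    -- Each side contains at most `2 C r_i + 2` integers; `1 ≤ r i` absorbs the `2`.
    _ ≤ ∏ i, (2 * C + 2) * r i := by
        refine Finset.prod_le_prod (fun i _ => Nat.cast_nonneg _) fun i _ => ?_
        have hrC : 0 ≤ C * r i := mul_nonneg hCpos.le (zero_le_one.trans (hr i))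
        have hmono : ⌊-(C * r i)⌋ ≤ ⌊C * r i⌋ := Int.floor_le_floor (by linarith)
        have hcast : (((⌊C * r i⌋ + 1 - ⌊-(C * r i)⌋).toNat : ℕ) : ℝ) =
            ⌊C * r i⌋ + 1 - ⌊-(C * r i)⌋ := by
          have : (((⌊C * r i⌋ + 1 - ⌊-(C * r i)⌋).toNat : ℕ) : ℤ) =
            ⌊C * r i⌋ + 1 - ⌊-(C * r i)⌋ := Int.toNat_of_nonneg (by omega)
          exact_mod_cast this
        rw [Int.card_Icc, hcast]
        have h1 := Int.floor_le (C * r i)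
        have h2 := Int.lt_floor_add_one (-(C * r i))
        nlinarith [hr i]

/-! ### Lattice points in sums of iterated images of a box -/

/-- The sums `∑_{k < n} Tᵏ x_k` of lattice points `x_k` with coordinates of modulus at most `N`. -/
def orbitSumset {p : ℕ} (T : Matrix (Fin p) (Fin p) ℤ) (N n : ℕ) : Set (Fin p → ℤ) :=
  {x | ∃ y : ℕ → Fin p → ℤ, (∀ k i, |y k i| ≤ N) ∧
    x = ∑ k ∈ Finset.range n, (T ^ k).mulVec (y k)}

/-- The product of the moduli of the eigenvalues of modulus at least one. -/
def expansionRate {p : ℕ} (T : Matrix (Fin p) (Fin p) ℤ) : ℝ :=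
  ((T.map (Int.cast : ℤ → ℂ)).charpoly.roots.map fun z => max 1 ‖z‖).prod

theorem exists_ncard_orbitSumset_le {p : ℕ} (T : Matrix (Fin p) (Fin p) ℤ) :
    ∃ (C : ℝ) (q : ℕ), 0 < C ∧ ∀ N n : ℕ, 1 ≤ N → 1 ≤ n →
      (orbitSumset T N n).Finite ∧
      ((orbitSumset T N n).ncard : ℝ) ≤ C * ((N : ℝ) * n) ^ q * expansionRate T ^ n := by
  classical
  set Tc : Matrix (Fin p) (Fin p) ℂ := T.map (Int.cast : ℤ → ℂ) with hTc
  obtain ⟨b, μ, hb, hμ⟩ := exists_basis_maxGenEigenspace (ι := Fin p) (V := Fin p → ℂ)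
    (by simp) (Matrix.toLin' Tc.transpose)
  rw [Matrix.charpoly_toLin', Matrix.charpoly_transpose] at hμ
  have hgrowth : ∀ i, ∃ C : ℝ, 0 ≤ C ∧ ∀ k : ℕ,
      ‖((Matrix.toLin' Tc.transpose) ^ k) (b i)‖ ≤ C * (k + 1) ^ p * max 1 ‖μ i‖ ^ k := by
    intro i
    apply exists_norm_pow_apply_le
    have := hb i
    rw [Module.End.maxGenEigenspace_eq_genEigenspace_finrank, Module.End.mem_genEigenspace_nat,
      LinearMap.mem_ker] at this
    simpa [Algebra.algebraMap_eq_smul_one] using this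
  choose C hC0 hC using hgrowth
  let A : Matrix (Fin p) (Fin p) ℂ := fun i j => b i j
  have hA : A.det ≠ 0 := by
    have h1 : LinearIndependent ℂ A.row := b.linearIndependent
    exact ((Matrix.isUnit_iff_isUnit_det _).1
      (Matrix.linearIndependent_rows_iff_isUnit.1 h1)).ne_zero
  obtain ⟨B, hB, hBA⟩ := exists_re_im_det_ne_zero A hA
  obtain ⟨K, hK, hcount⟩ := exists_ncard_le_prod B hB
  set D : ℝ := 1 + ∑ i, p * C i with hD
  have hD1 : 1 ≤ D := by
    rw [hD]
    have : 0 ≤ ∑ i, p * C i := Finset.sum_nonneg fun i _ => mul_nonneg (Nat.cast_nonneg _) (hC0 i)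
    linarith
  have hDi : ∀ i, p * C i ≤ D := fun i => by
    have : p * C i ≤ ∑ i, p * C i := Finset.single_le_sum (f := fun i => (p : ℝ) * C i)
      (fun i _ => mul_nonneg (Nat.cast_nonneg _) (hC0 i)) (Finset.mem_univ i)
    linarith
  refine ⟨(K * D) ^ p, (p + 1) * p, by positivity, fun N n hN hn => ?_⟩
  have hN' : (1 : ℝ) ≤ N := by exact_mod_cast hN
  have hn' : (1 : ℝ) ≤ n := by exact_mod_cast hn
  have hNn : (1 : ℝ) ≤ N * n := one_le_mul_of_one_le_of_one_le hN' hn'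
  -- The nilpotency order is at most `p`, giving `n ^ p`; summing over `k < n` gives one more factor
  -- `n`. Multiplying over the `p` forms yields the exponent `(p + 1) * p`.
  let r : Fin p → ℝ := fun i => D * ((N : ℝ) * n) ^ (p + 1) * max 1 ‖μ i‖ ^ n
  have hr : ∀ i, 1 ≤ r i := fun i =>
    one_le_mul_of_one_le_of_one_le (one_le_mul_of_one_le_of_one_le hD1 (one_le_pow₀ hNn))
      (one_le_pow₀ (le_max_left _ _))
  have hpair : ∀ x ∈ orbitSumset T N n, ∀ i, ‖A.mulVec (fun j => (x j : ℂ)) i‖ ≤ r i := by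
    rintro x ⟨y, hy, rfl⟩ i
    have hstep : ∀ k, ‖b i ⬝ᵥ (fun j => (((T ^ k).mulVec (y k) j : ℤ) : ℂ))‖ ≤
        p * (C i * (k + 1) ^ p * max 1 ‖μ i‖ ^ k) * N := by
      intro k
      have e : (fun j => (((T ^ k).mulVec (y k) j : ℤ) : ℂ)) =
          (Tc ^ k).mulVec (fun j => (y k j : ℂ)) := by
        have h1 : Tc ^ k = (T ^ k).map (Int.cast : ℤ → ℂ) :=
          (map_pow (Int.castRingHom ℂ).mapMatrix T k).symm
        rw [h1]
        funext j
        simp [Matrix.mulVec, dotProduct]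
      have e2 : ((Matrix.toLin' Tc.transpose) ^ k) (b i) = Matrix.vecMul (b i) (Tc ^ k) := by
        rw [← Matrix.toLin'_pow, Matrix.toLin'_apply, ← Matrix.transpose_pow,
          Matrix.mulVec_transpose]
      rw [e, Matrix.dotProduct_mulVec, ← e2]
      calc ‖((Matrix.toLin' Tc.transpose) ^ k) (b i) ⬝ᵥ (fun j => (y k j : ℂ))‖
          ≤ ∑ _j : Fin p, ‖((Matrix.toLin' Tc.transpose) ^ k) (b i)‖ * N := by
            refine (norm_sum_le _ _).trans (Finset.sum_le_sum fun j _ => ?_)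
            rw [norm_mul]
            refine mul_le_mul (norm_le_pi_norm _ j) ?_ (norm_nonneg _) (norm_nonneg _)
            rw [Complex.norm_intCast]
            exact_mod_cast hy k j
        _ = p * ‖((Matrix.toLin' Tc.transpose) ^ k) (b i)‖ * N := by simp [mul_assoc]
        _ ≤ _ := by
            gcongr
            exact hC i k
    have hsum : A.mulVec (fun j => ((∑ k ∈ Finset.range n, (T ^ k).mulVec (y k)) j : ℂ)) i =
        ∑ k ∈ Finset.range n, b i ⬝ᵥ (fun j => (((T ^ k).mulVec (y k) j : ℤ) : ℂ)) := by
      rw [← dotProduct_sum]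
      change b i ⬝ᵥ _ = b i ⬝ᵥ _
      congr 1
      funext j
      simp [Finset.sum_apply]
    rw [hsum]
    have hMi : 1 ≤ max 1 ‖μ i‖ := le_max_left _ _
    calc ‖∑ k ∈ Finset.range n, b i ⬝ᵥ (fun j => (((T ^ k).mulVec (y k) j : ℤ) : ℂ))‖
        ≤ ∑ k ∈ Finset.range n, D * (n : ℝ) ^ p * max 1 ‖μ i‖ ^ n * N := by
          refine (norm_sum_le _ _).trans (Finset.sum_le_sum fun k hk => (hstep k).trans ?_)
          have hkn : k + 1 ≤ n := Finset.mem_range.1 hk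
          have hkn' : (k : ℝ) + 1 ≤ n := by exact_mod_cast hkn
          rw [← mul_assoc, ← mul_assoc]
          gcongr
          · exact hDi i
          · omega
      _ = D * ((N * (n : ℝ) ^ (p + 1)) * max 1 ‖μ i‖ ^ n) := by
          rw [Finset.sum_const, Finset.card_range, nsmul_eq_mul]
          ring
      _ ≤ D * (((N : ℝ) ^ (p + 1) * (n : ℝ) ^ (p + 1)) * max 1 ‖μ i‖ ^ n) := by
          gcongr
          exact le_self_pow₀ hN' (by omega)
      _ = r i := by
          simp only [r, mul_pow]
          ring
  have hreal : ∀ x ∈ orbitSumset T N n, ∀ i, |B.mulVec (fun j => (x j : ℝ)) i| ≤ r i := by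
    intro x hx i
    refine le_trans ?_ (hpair x hx i)
    rcases hBA i with h | h
    · have : B.mulVec (fun j => (x j : ℝ)) i = (A.mulVec (fun j => (x j : ℂ)) i).re := by
        simp [Matrix.mulVec, dotProduct, h]
      rw [this]
      exact Complex.abs_re_le_norm _
    · have : B.mulVec (fun j => (x j : ℝ)) i = (A.mulVec (fun j => (x j : ℂ)) i).im := by
        simp [Matrix.mulVec, dotProduct, h]
      rw [this]
      exact Complex.abs_im_le_norm _
  obtain ⟨hfin, hle⟩ := hcount r _ hr hreal
  refine ⟨hfin, hle.trans_eq ?_⟩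
  have hrate : expansionRate T = ∏ i, max 1 ‖μ i‖ := by
    rw [expansionRate, ← hTc, ← hμ, Multiset.map_map]
    rfl
  rw [hrate]
  simp only [r, Finset.prod_mul_distrib, Finset.prod_const, Finset.prod_pow, Finset.card_univ,
    Fintype.card_fin, mul_pow, pow_mul]
  ring

theorem expansionRate_pos {p : ℕ} (T : Matrix (Fin p) (Fin p) ℤ) : 0 < expansionRate T := by
  refine Multiset.prod_pos fun x hx => ?_
  obtain ⟨z, -, rfl⟩ := Multiset.mem_map.1 hx
  exact zero_lt_one.trans_le (le_max_left _ _)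

theorem log_expansionRate {p : ℕ} (T : Matrix (Fin p) (Fin p) ℤ) :
    Real.log (expansionRate T) = sumLogEigenvalues T := by
  classical
  have key : ∀ s : Multiset ℂ, Real.log (s.map fun z => max 1 ‖z‖).prod =
      ((s.filter fun z => 1 ≤ ‖z‖).map fun z => Real.log ‖z‖).sum := by
    intro s
    induction s using Multiset.induction_on with
    | empty => simp
    | cons z s ih =>
      have hpos : 0 < (s.map fun z => max 1 ‖z‖).prod := by
        refine Multiset.prod_pos fun x hx => ?_
        obtain ⟨z, -, rfl⟩ := Multiset.mem_map.1 hx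
        exact zero_lt_one.trans_le (le_max_left _ _)
      rw [Multiset.map_cons, Multiset.prod_cons, Real.log_mul
        (zero_lt_one.trans_le (le_max_left _ _)).ne' hpos.ne', ih]
      by_cases hz : 1 ≤ ‖z‖
      · rw [Multiset.filter_cons_of_pos (p := fun z : ℂ => 1 ≤ ‖z‖) _ hz, Multiset.map_cons, Multiset.sum_cons,
          max_eq_right hz]
      · rw [Multiset.filter_cons_of_neg (p := fun z : ℂ => 1 ≤ ‖z‖) _ hz, max_eq_left (not_le.1 hz).le, Real.log_one, zero_add]
  rw [expansionRate, key, sumLogEigenvalues]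

/-! ### Monomials in unitaries commuting up to phases -/

section Monomials

variable {p : ℕ}

/-- Applied to unitaries modulo scalars, where the generators commute: ordered monomials become a
homomorphism from `ℤᵖ`, and no phase has to be computed. The subgroup generated by the `a i` is
commutative, so the unordered product is available there. -/
theorem exists_monoidHom_ofFn_zpow_prod {G : Type*} [Group G] (a : Fin p → G)
    (ha : ∀ i j, a i * a j = a j * a i) :
    ∃ Φ : Multiplicative (Fin p → ℤ) →* G,
      ∀ g : Fin p → ℤ, Φ (Multiplicative.ofAdd g) = (List.ofFn fun i => a i ^ g i).prod := by
  have hcomm : ∀ x ∈ Set.range a, ∀ y ∈ Set.range a, x * y = y * x := by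
    rintro _ ⟨i, rfl⟩ _ ⟨j, rfl⟩
    exact ha i j
  have hH := Subgroup.isMulCommutative_closure hcomm
  let _ : CommGroup (Subgroup.closure (Set.range a)) :=
    { (inferInstance : Group (Subgroup.closure (Set.range a))) with
      mul_comm := hH.is_comm.comm }
  let b : Fin p → Subgroup.closure (Set.range a) :=
    fun i => ⟨a i, Subgroup.subset_closure ⟨i, rfl⟩⟩
  let Ψ : Multiplicative (Fin p → ℤ) →* Subgroup.closure (Set.range a) :=
    { toFun := fun g => ∏ i, b i ^ (Multiplicative.toAdd g) i
      map_one' := by simp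
      map_mul' := fun g h => by simp [zpow_add, Finset.prod_mul_distrib] }
  refine ⟨(Subgroup.closure (Set.range a)).subtype.comp Ψ, fun g => ?_⟩
  have h1 : Ψ (Multiplicative.ofAdd g) = (List.ofFn fun i => b i ^ g i).prod := by
    rw [List.prod_ofFn]
    rfl
  rw [MonoidHom.comp_apply, h1, map_list_prod, List.map_ofFn]
  rfl

variable {A : Type*} [CStarAlgebra A]

/-- The scalar unitary `z • 1`. -/
def scalarUnitary (A : Type*) [CStarAlgebra A] : Circle →* unitary A where
  toFun z := ⟨(z : ℂ) • (1 : A), by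
    have h : star (z : ℂ) * (z : ℂ) = 1 := by
      simp [← Circle.coe_inv_eq_conj]
    rw [Unitary.mem_iff, star_smul, smul_mul_smul_comm, smul_mul_smul_comm, mul_comm (z : ℂ), h]
    simp⟩
  map_one' := by
    ext
    simp
  map_mul' z w := by
    ext
    simp [smul_smul, mul_comm]

theorem coe_scalarUnitary_mul (z : Circle) (x : unitary A) :
    ((scalarUnitary A z * x : unitary A) : A) = (z : ℂ) • (x : A) := by
  simp [scalarUnitary]

theorem scalarUnitary_commute (z : Circle) (x : unitary A) : Commute (scalarUnitary A z) x := by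
  ext
  simp [scalarUnitary]

instance normal_range_scalarUnitary : (scalarUnitary A).range.Normal where
  conj_mem := by
    rintro _ ⟨z, rfl⟩ g
    refine ⟨z, ?_⟩
    rw [← (scalarUnitary_commute z g).eq, mul_inv_cancel_right]

theorem mk_eq_mk_iff {x y : unitary A} :
    (x : unitary A ⧸ (scalarUnitary A).range) = y ↔ ∃ z : Circle, (y : A) = (z : ℂ) • (x : A) := by
  rw [QuotientGroup.eq]
  constructor
  · rintro ⟨z, hz⟩
    refine ⟨z, ?_⟩
    rw [← coe_scalarUnitary_mul, (scalarUnitary_commute z x).eq, hz, mul_inv_cancel_left]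
  · rintro ⟨z, hz⟩
    refine ⟨z, ?_⟩
    rw [← coe_scalarUnitary_mul] at hz
    rw [Subtype.ext hz, (scalarUnitary_commute z x).eq, inv_mul_cancel_left]

/-- The ordered monomial `u_1^{g_1} ⋯ u_p^{g_p}`. -/
def monomialUnitary (u : Fin p → unitary A) (g : Fin p → ℤ) : unitary A :=
  (List.ofFn fun i => u i ^ g i).prod

/-- The unitaries `u_j` commute up to phases. -/
def PhaseCommuting (u : Fin p → unitary A) : Prop :=
  ∀ i j, ∃ z : Circle, (u j : A) * u i = (z : ℂ) • ((u i : A) * u j)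

theorem PhaseCommuting.exists_monoidHom {u : Fin p → unitary A} (hu : PhaseCommuting u) :
    ∃ Φ : Multiplicative (Fin p → ℤ) →* unitary A ⧸ (scalarUnitary A).range,
      ∀ g : Fin p → ℤ, Φ (Multiplicative.ofAdd g) = monomialUnitary u g := by
  obtain ⟨Φ, hΦ⟩ := exists_monoidHom_ofFn_zpow_prod
    (fun i => (u i : unitary A ⧸ (scalarUnitary A).range)) (fun i j => by
      obtain ⟨z, hz⟩ := hu i j
      exact mk_eq_mk_iff.2 ⟨z, hz⟩)
  refine ⟨Φ, fun g => (hΦ g).trans ?_⟩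
  rw [monomialUnitary, ← QuotientGroup.mk'_apply, map_list_prod, List.map_ofFn]
  rfl

theorem PhaseCommuting.monomial_mul {u : Fin p → unitary A} (hu : PhaseCommuting u)
    (g h : Fin p → ℤ) : ∃ z : Circle, (monomialUnitary u g : A) * monomialUnitary u h =
      (z : ℂ) • (monomialUnitary u (g + h) : A) := by
  obtain ⟨Φ, hΦ⟩ := hu.exists_monoidHom
  have : ((monomialUnitary u (g + h) : unitary A) : unitary A ⧸ (scalarUnitary A).range) =
      (monomialUnitary u g * monomialUnitary u h : unitary A) := by
    rw [QuotientGroup.mk_mul, ← hΦ, ← hΦ, ← hΦ, ofAdd_add, map_mul]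
  exact mk_eq_mk_iff.1 this

theorem PhaseCommuting.star_monomial {u : Fin p → unitary A} (hu : PhaseCommuting u)
    (g : Fin p → ℤ) : ∃ z : Circle, star (monomialUnitary u g : A) =
      (z : ℂ) • (monomialUnitary u (-g) : A) := by
  obtain ⟨Φ, hΦ⟩ := hu.exists_monoidHom
  have : ((monomialUnitary u (-g) : unitary A) : unitary A ⧸ (scalarUnitary A).range) =
      ((monomialUnitary u g)⁻¹ : unitary A) := by
    rw [QuotientGroup.mk_inv, ← hΦ, ← hΦ, ofAdd_neg, map_inv]
  exact mk_eq_mk_iff.1 this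

theorem monomialUnitary_zero (u : Fin p → unitary A) : monomialUnitary u 0 = 1 := by
  simp [monomialUnitary]

theorem monomialUnitary_single (u : Fin p → unitary A) (j : Fin p) :
    monomialUnitary u (Pi.single j 1) = u j := by
  have : ∀ {q : ℕ} (v : Fin q → unitary A) (j : Fin q),
      (List.ofFn fun i => v i ^ (Pi.single j 1 : Fin q → ℤ) i).prod = v j := by
    intro q
    induction q with
    | zero => intro v j; exact j.elim0
    | succ q ih =>
      intro v j
      rw [List.ofFn_succ, List.prod_cons]
      induction j using Fin.cases with
      | zero => simp [Fin.succ_ne_zero]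
      | succ j =>
        refine Eq.trans ?_ (ih (fun i => v i.succ) j)
        simp [Pi.single_apply, (Fin.succ_ne_zero j).symm]
  exact this u j

/-- The unital *-homomorphism `f` as a homomorphism between unitary groups. -/
def unitaryMap {B : Type*} [CStarAlgebra B] (f : A →⋆ₐ[ℂ] B) : unitary A →* unitary B where
  toFun x := ⟨f (x : A), Unitary.map_mem f x.2⟩
  map_one' := Subtype.ext (map_one f)
  map_mul' x y := Subtype.ext (map_mul f (x : A) y)

/-- Modulo scalars `f (u j)` is the image of the `j`-th column of `T` under the homomorphism `Φ`, so
powers and products of columns add up to `T.mulVec g`. -/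
theorem PhaseCommuting.map_monomial {u : Fin p → unitary A} (hu : PhaseCommuting u)
    (f : A →⋆ₐ[ℂ] A) (T : Matrix (Fin p) (Fin p) ℤ)
    (hf : ∀ j, ∃ z : Circle, f (u j) = (z : ℂ) • (monomialUnitary u (fun i => T i j) : A))
    (g : Fin p → ℤ) : ∃ z : Circle, f (monomialUnitary u g) =
      (z : ℂ) • (monomialUnitary u (T.mulVec g) : A) := by
  obtain ⟨Φ, hΦ⟩ := hu.exists_monoidHom
  have hj : ∀ j, ((unitaryMap f (u j) : unitary A) : unitary A ⧸ (scalarUnitary A).range) =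
      Φ (Multiplicative.ofAdd fun i => T i j) := fun j => by
    rw [hΦ]
    exact (mk_eq_mk_iff.2 (hf j)).symm
  have key : ((unitaryMap f (monomialUnitary u g) : unitary A) :
      unitary A ⧸ (scalarUnitary A).range) = monomialUnitary u (T.mulVec g) := by
    rw [← hΦ, monomialUnitary, map_list_prod, List.map_ofFn, ← QuotientGroup.mk'_apply,
      map_list_prod, List.map_ofFn]
    have e : (QuotientGroup.mk' (scalarUnitary A).range ∘ unitaryMap f ∘ fun i => u i ^ g i) =
        Φ ∘ fun i => (Multiplicative.ofAdd fun k => T k i) ^ g i := by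
      funext i
      simp only [Function.comp_apply, map_zpow, QuotientGroup.mk'_apply]
      rw [← hj]
    rw [e, ← List.map_ofFn, ← map_list_prod, List.prod_ofFn]
    congr 1
    apply Multiplicative.toAdd.injective
    rw [toAdd_prod]
    funext k
    simp [Matrix.mulVec, dotProduct, Finset.sum_apply, mul_comm]
  exact mk_eq_mk_iff.1 key.symm

theorem monomialUnitary_smul (u v : Fin p → unitary A) (z : Fin p → Circle)
    (h : ∀ i, (v i : A) = (z i : ℂ) • (u i : A)) (g : Fin p → ℤ) :
    (monomialUnitary v g : A) =
      ((∏ i, z i ^ g i : Circle) : ℂ) • (monomialUnitary u g : A) := by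
  have h' : ∀ i, v i ^ g i = scalarUnitary A (z i ^ g i) * u i ^ g i := fun i => by
    have : v i = scalarUnitary A (z i) * u i := by
      ext
      rw [coe_scalarUnitary_mul, h]
    rw [this, (scalarUnitary_commute _ _).mul_zpow, map_zpow]
  have key : ∀ {q : ℕ} (w : Fin q → Circle) (x : Fin q → unitary A),
      (List.ofFn fun i => scalarUnitary A (w i) * x i).prod =
        scalarUnitary A (∏ i, w i) * (List.ofFn x).prod := by
    intro q
    induction q with
    | zero => intro w x; simp
    | succ q ih =>
      intro w x
      rw [List.ofFn_succ, List.prod_cons, ih, Fin.prod_univ_succ, List.ofFn_succ, List.prod_cons,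
        map_mul, mul_assoc, mul_assoc, ← mul_assoc (x 0), ← (scalarUnitary_commute _ (x 0)).eq]
      simp only [mul_assoc]
  rw [← coe_scalarUnitary_mul, monomialUnitary, monomialUnitary, ← key]
  simp only [h']

/-- The linear span of the monomials with exponents in `S`. -/
def polySpan (u : Fin p → unitary A) (S : Set (Fin p → ℤ)) : Submodule ℂ A :=
  Submodule.span ℂ ((fun g => (monomialUnitary u g : A)) '' S)

theorem monomial_mem_polySpan (u : Fin p → unitary A) {S : Set (Fin p → ℤ)} {g : Fin p → ℤ}
    (hg : g ∈ S) : (monomialUnitary u g : A) ∈ polySpan u S :=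
  Submodule.subset_span ⟨g, hg, rfl⟩

theorem polySpan_mono (u : Fin p → unitary A) {S S' : Set (Fin p → ℤ)} (h : S ⊆ S') :
    polySpan u S ≤ polySpan u S' :=
  Submodule.span_mono (Set.image_mono h)

theorem finiteDimensional_polySpan (u : Fin p → unitary A) {S : Set (Fin p → ℤ)} (hS : S.Finite) :
    FiniteDimensional ℂ (polySpan u S) :=
  FiniteDimensional.span_of_finite ℂ (hS.image _)

theorem finrank_polySpan_le (u : Fin p → unitary A) {S : Set (Fin p → ℤ)} (hS : S.Finite) :
    Module.finrank ℂ (polySpan u S) ≤ S.ncard := by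
  classical
  have : Fintype ((fun g => (monomialUnitary u g : A)) '' S) := (hS.image _).fintype
  refine (finrank_span_le_card _).trans ?_
  rw [← Set.ncard_eq_toFinset_card']
  exact Set.ncard_image_le hS

theorem PhaseCommuting.mul_mem_polySpan {u : Fin p → unitary A} (hu : PhaseCommuting u)
    {S S' S'' : Set (Fin p → ℤ)} (h : ∀ g ∈ S, ∀ g' ∈ S', g + g' ∈ S'') {x y : A}
    (hx : x ∈ polySpan u S) (hy : y ∈ polySpan u S') : x * y ∈ polySpan u S'' := by
  induction hx using Submodule.span_induction with
  | zero => simp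
  | add a b _ _ ha hb => rw [add_mul]; exact add_mem ha hb
  | smul c a _ ha => rw [smul_mul_assoc]; exact Submodule.smul_mem _ _ ha
  | mem x hx =>
    obtain ⟨g, hg, rfl⟩ := hx
    induction hy using Submodule.span_induction with
    | zero => simp
    | add a b _ _ ha hb => rw [mul_add]; exact add_mem ha hb
    | smul c a _ ha => rw [mul_smul_comm]; exact Submodule.smul_mem _ _ ha
    | mem y hy =>
      obtain ⟨g', hg', rfl⟩ := hy
      obtain ⟨z, hz⟩ := hu.monomial_mul g g'
      simp only [hz]
      exact Submodule.smul_mem _ _ (monomial_mem_polySpan u (h g hg g' hg'))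

theorem map_mem_polySpan (u : Fin p → unitary A) {S S' : Set (Fin p → ℤ)} (f : A →ₗ[ℂ] A)
    (h : ∀ g ∈ S, f (monomialUnitary u g) ∈ polySpan u S') {x : A} (hx : x ∈ polySpan u S) :
    f x ∈ polySpan u S' := by
  have : polySpan u S ≤ (polySpan u S').comap f := by
    refine Submodule.span_le.2 ?_
    rintro _ ⟨g, hg, rfl⟩
    exact h g hg
  exact this hx

theorem PhaseCommuting.star_mem_polySpan {u : Fin p → unitary A} (hu : PhaseCommuting u)
    {x : A} (hx : x ∈ polySpan u Set.univ) : star x ∈ polySpan u Set.univ := by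
  induction hx using Submodule.span_induction with
  | zero => simp
  | add a b _ _ ha hb => rw [star_add]; exact add_mem ha hb
  | smul c a _ ha => rw [star_smul]; exact Submodule.smul_mem _ _ ha
  | mem x hx =>
    obtain ⟨g, -, rfl⟩ := hx
    obtain ⟨z, hz⟩ := hu.star_monomial g
    simp only [hz]
    exact Submodule.smul_mem _ _ (monomial_mem_polySpan u (Set.mem_univ _))

/-- The *-algebra of polynomials in the unitaries `u_j`. -/
def PhaseCommuting.polyStarSubalgebra {u : Fin p → unitary A} (hu : PhaseCommuting u) :
    StarSubalgebra ℂ A where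
  carrier := polySpan u Set.univ
  mul_mem' := hu.mul_mem_polySpan fun _ _ _ _ => Set.mem_univ _
  add_mem' := add_mem
  algebraMap_mem' c := by
    rw [Algebra.algebraMap_eq_smul_one]
    refine Submodule.smul_mem _ _ ?_
    have := monomial_mem_polySpan u (Set.mem_univ 0)
    rwa [monomialUnitary_zero] at this
  star_mem' := hu.star_mem_polySpan

theorem exists_mem_polySpan_box (u : Fin p → unitary A) {x : A}
    (hx : x ∈ polySpan u Set.univ) : ∃ M : ℕ, x ∈ polySpan u {g | ∀ i, |g i| ≤ M} := by
  induction hx using Submodule.span_induction with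
  | zero => exact ⟨0, zero_mem _⟩
  | add a b _ _ ha hb =>
    obtain ⟨M, hM⟩ := ha
    obtain ⟨M', hM'⟩ := hb
    have hmono : ∀ {k l : ℕ}, k ≤ l →
        {g : Fin p → ℤ | ∀ i, |g i| ≤ k} ⊆ {g | ∀ i, |g i| ≤ l} :=
      fun h g hg i => (hg i).trans (Nat.cast_le.2 h)
    exact ⟨max M M', add_mem (polySpan_mono u (hmono (le_max_left _ _)) hM)
      (polySpan_mono u (hmono (le_max_right _ _)) hM')⟩
  | smul c a _ ha =>
    obtain ⟨M, hM⟩ := ha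
    exact ⟨M, Submodule.smul_mem _ _ hM⟩
  | mem x hx =>
    obtain ⟨g, -, rfl⟩ := hx
    refine ⟨∑ i, (g i).natAbs, monomial_mem_polySpan u fun i => ?_⟩
    rw [Int.abs_eq_natAbs]
    exact_mod_cast Finset.single_le_sum (f := fun i => (g i).natAbs)
      (fun _ _ => Nat.zero_le _) (Finset.mem_univ i)

end Monomials

/-! ### Density of polynomials in `A_ρ` and the torus action on monomials. -/

namespace NCTorus

variable {p : ℕ} (ρ : AntisymmBichar p)

theorem phaseCommuting_u : PhaseCommuting (u ρ) := fun i j => ⟨ρ.entry i j, u_mul_u ρ i j⟩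

theorem exists_polySpan_norm_sub_lt (a : NCTorus ρ) {ε : ℝ} (hε : 0 < ε) :
    ∃ b ∈ polySpan (u ρ) Set.univ, ‖a - b‖ < ε := by
  have hle : StarAlgebra.adjoin ℂ (Set.range fun j => (TorusProd.gen ρ j : TorusProd ρ)) ≤
      (phaseCommuting_u ρ).polyStarSubalgebra.map (incl ρ) := by
    refine StarAlgebra.adjoin_le ?_
    rintro _ ⟨j, rfl⟩
    refine ⟨u ρ j, ?_, rfl⟩
    have := monomial_mem_polySpan (u ρ) (Set.mem_univ (Pi.single j 1))
    rwa [monomialUnitary_single] at this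
  have ha : incl ρ a ∈ closure
      ((StarAlgebra.adjoin ℂ (Set.range fun j => (TorusProd.gen ρ j : TorusProd ρ)) :
        StarSubalgebra ℂ (TorusProd ρ)) : Set (TorusProd ρ)) := incl_mem ρ a
  obtain ⟨y, hy, hlt⟩ := Metric.mem_closure_iff.1 ha ε hε
  obtain ⟨b, hb, rfl⟩ := hle hy
  refine ⟨b, hb, ?_⟩
  rw [dist_eq_norm] at hlt
  rw [← norm_incl, map_sub]
  exact hlt

theorem γ_monomial (t : Fin p → UnitAddCircle) (g : Fin p → ℤ) :
    γ ρ t (monomialUnitary (u ρ) g) =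
      ((∏ i, (t i).toCircle ^ g i : Circle) : ℂ) • (monomialUnitary (u ρ) g : NCTorus ρ) := by
  rw [← monomialUnitary_smul (u ρ) (fun i => unitaryMap (γ ρ t : NCTorus ρ →⋆ₐ[ℂ] NCTorus ρ) (u ρ i))
    (fun i => (t i).toCircle) (fun i => γ_u ρ t i) g]
  have : unitaryMap (γ ρ t : NCTorus ρ →⋆ₐ[ℂ] NCTorus ρ) (monomialUnitary (u ρ) g) =
      monomialUnitary (fun i => unitaryMap (γ ρ t : NCTorus ρ →⋆ₐ[ℂ] NCTorus ρ) (u ρ i)) g := by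
    rw [monomialUnitary, monomialUnitary, map_list_prod, List.map_ofFn]
    congr 2
    funext i
    exact map_zpow _ _ _
  exact congrArg Subtype.val this

end NCTorus

/-! ### The Fejér kernel on a finite cyclic group -/

/-- The Fejér kernel of order `N`. -/
def fejer (N : ℕ) (z : Circle) : ℝ := ‖∑ k ∈ Finset.range N, (z : ℂ) ^ k‖ ^ 2 / N

theorem fejer_nonneg (N : ℕ) (z : Circle) : 0 ≤ fejer N z := by
  unfold fejer
  positivity

theorem fejer_eq_sum (N : ℕ) (z : Circle) :
    (fejer N z : ℂ) = (N : ℂ)⁻¹ * ∑ k ∈ Finset.range N, ∑ l ∈ Finset.range N,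
      (z : ℂ) ^ ((k : ℤ) - l) := by
  have h1 : (fejer N z : ℂ) = ((‖∑ k ∈ Finset.range N, (z : ℂ) ^ k‖ : ℂ) ^ 2) / N := by
    simp [fejer]
  have hz : (z : ℂ) ≠ 0 := Circle.coe_ne_zero z
  rw [h1, ← Complex.mul_conj', map_sum, Finset.sum_mul_sum, div_eq_inv_mul]
  congr 1
  refine Finset.sum_congr rfl fun k _ => Finset.sum_congr rfl fun l _ => ?_
  rw [map_pow, ← Circle.coe_inv_eq_conj, Circle.coe_inv, zpow_sub₀ hz, zpow_natCast, zpow_natCast,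
    inv_pow, div_eq_mul_inv]

/-- The point `m / M` of the circle group. -/
def rationalPoint (M m : ℕ) : UnitAddCircle := ((m / M : ℝ) : UnitAddCircle)

theorem sum_toCircle_rationalPoint_zpow {M : ℕ} (hM : M ≠ 0) (d : ℤ) :
    ∑ m ∈ Finset.range M, ((rationalPoint M m).toCircle : ℂ) ^ d =
      if (M : ℤ) ∣ d then (M : ℂ) else 0 := by
  have hprim := Complex.isPrimitiveRoot_exp M hM
  set ζ := Complex.exp (2 * Real.pi * Complex.I / M)
  have hpt : ∀ m, ((rationalPoint M m).toCircle : ℂ) ^ d = (ζ ^ d) ^ m := by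
    intro m
    have : ((rationalPoint M m).toCircle : ℂ) = ζ ^ m := by
      rw [rationalPoint, AddCircle.toCircle_apply_mk, Circle.coe_exp, ← Complex.exp_nat_mul]
      congr 1
      push_cast
      ring
    rw [this, ← zpow_natCast, ← zpow_natCast, ← zpow_mul, ← zpow_mul, mul_comm]
  rw [Finset.sum_congr rfl fun m _ => hpt m]
  split_ifs with h
  · rw [(hprim.zpow_eq_one_iff_dvd d).2 h]
    simp
  · have hne : ζ ^ d ≠ 1 := fun h' => h ((hprim.zpow_eq_one_iff_dvd d).1 h')
    have hgeom := geom_sum_mul (ζ ^ d) M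
    rw [← zpow_natCast (ζ ^ d) M, ← zpow_mul, mul_comm d, zpow_mul, zpow_natCast, hprim.pow_eq_one,
      one_zpow, sub_self] at hgeom
    exact (mul_eq_zero.1 hgeom).resolve_right (sub_ne_zero.2 hne)

theorem sum_fejer_mul_zpow {M N : ℕ} (hM : M ≠ 0) (d : ℤ) :
    ∑ m ∈ Finset.range M, (fejer N (rationalPoint M m).toCircle : ℂ) *
        ((rationalPoint M m).toCircle : ℂ) ^ d =
      (N : ℂ)⁻¹ * ∑ k ∈ Finset.range N, ∑ l ∈ Finset.range N,
        if (M : ℤ) ∣ (k : ℤ) - l + d then (M : ℂ) else 0 := by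
  simp_rw [fejer_eq_sum, mul_assoc, Finset.sum_mul, ← Finset.mul_sum]
  congr 1
  rw [Finset.sum_comm]
  refine Finset.sum_congr rfl fun k _ => ?_
  rw [Finset.sum_comm]
  refine Finset.sum_congr rfl fun l _ => ?_
  rw [← sum_toCircle_rationalPoint_zpow hM]
  refine Finset.sum_congr rfl fun m _ => ?_
  rw [zpow_add₀ (Circle.coe_ne_zero _)]

/-- Since `|k - l| < N ≤ M`, only the diagonal terms survive sampling at the `M`-th roots of unity.
-/
theorem sum_fejer {M N : ℕ} (hN : N ≠ 0) (hNM : N ≤ M) :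
    ∑ m ∈ Finset.range M, fejer N (rationalPoint M m).toCircle = M := by
  have h := sum_fejer_mul_zpow (N := N) (show M ≠ 0 by omega) 0
  have hdiag : ∀ k ∈ Finset.range N, (∑ l ∈ Finset.range N,
      if (M : ℤ) ∣ (k : ℤ) - l + 0 then (M : ℂ) else 0) = M := by
    intro k hk
    rw [Finset.sum_eq_single k]
    · simp
    · intro l hl hlk
      rw [Finset.mem_range] at hk hl
      refine if_neg fun hdvd => hlk ?_
      have := Int.eq_zero_of_abs_lt_dvd hdvd (by rw [abs_lt]; omega)
      omega
    · exact fun h => absurd hk h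
  rw [Finset.sum_congr rfl hdiag] at h
  simp only [zpow_zero, mul_one, Finset.sum_const, Finset.card_range, nsmul_eq_mul] at h
  rw [inv_mul_cancel_left₀ (by exact_mod_cast hN)] at h
  exact_mod_cast h

/-- The frequencies `k - l + d` are nonzero because `|k - l| < N ≤ |d|`, and smaller than `M` in
modulus, so none is aliased to `0`. -/
theorem sum_fejer_mul_zpow_eq_zero {M N : ℕ} {d : ℤ} (hM : M ≠ 0) (h1 : (N : ℤ) ≤ |d|)
    (h2 : |d| + N ≤ M) :
    ∑ m ∈ Finset.range M, (fejer N (rationalPoint M m).toCircle : ℂ) *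
        ((rationalPoint M m).toCircle : ℂ) ^ d = 0 := by
  rw [sum_fejer_mul_zpow hM, Finset.sum_eq_zero, mul_zero]
  refine fun k hk => Finset.sum_eq_zero fun l hl => if_neg fun hdvd => ?_
  rw [Finset.mem_range] at hk hl
  have := Int.eq_zero_of_abs_lt_dvd hdvd (by
    rw [abs_lt]
    rcases abs_cases d with h | h <;> omega)
  rcases abs_cases d with h | h <;> omega

theorem four_mul_norm_le_norm_toCircle_sub_one (θ : UnitAddCircle) :
    4 * ‖θ‖ ≤ ‖(θ.toCircle : ℂ) - 1‖ := by
  obtain ⟨x, rfl⟩ := QuotientAddGroup.mk_surjective θ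
  change 4 * ‖(x : UnitAddCircle)‖ ≤ ‖(AddCircle.toCircle (x : UnitAddCircle) : ℂ) - 1‖
  have hxy : (x : UnitAddCircle) = ((x - round x : ℝ) : UnitAddCircle) := by
    rw [AddCircle.coe_sub]
    have : ((round x : ℝ) : UnitAddCircle) = 0 := by
      rw [AddCircle.coe_eq_zero_iff]
      exact ⟨round x, by simp⟩
    rw [this, sub_zero]
  have hnorm : ‖(x : UnitAddCircle)‖ = |x - round x| := UnitAddCircle.norm_eq
  rw [hnorm, hxy]
  set y := x - round x
  have hy : |y| ≤ 1 / 2 := abs_sub_round x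
  have e : (AddCircle.toCircle (y : UnitAddCircle) : ℂ) = Complex.exp (Complex.I * ((2 * Real.pi * y : ℝ) : ℂ)) := by
    rw [AddCircle.toCircle_apply_mk, Circle.coe_exp]
    congr 1
    push_cast
    ring
  rw [e, Complex.norm_exp_I_mul_ofReal_sub_one]
  have hs := Real.mul_abs_le_abs_sin (x := Real.pi * y) (by
    rw [abs_mul, abs_of_pos Real.pi_pos]
    nlinarith [Real.pi_pos])
  rw [abs_mul, abs_of_pos Real.pi_pos] at hs
  have h2 : 2 * Real.pi * y / 2 = Real.pi * y := by ring
  rw [h2, Real.norm_eq_abs, abs_mul, abs_two]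
  have h3 : 2 / Real.pi * (Real.pi * |y|) = 2 * |y| := by
    field_simp
  linarith

theorem fejer_mul_norm_sq_le (N : ℕ) (θ : UnitAddCircle) :
    fejer N θ.toCircle * ‖θ‖ ^ 2 ≤ 1 / (4 * N) := by
  have h1 := four_mul_norm_le_norm_toCircle_sub_one θ
  set z := θ.toCircle
  have h2 : ‖∑ k ∈ Finset.range N, (z : ℂ) ^ k‖ * ‖(z : ℂ) - 1‖ ≤ 2 := by
    rw [← norm_mul, geom_sum_mul]
    refine (norm_sub_le _ _).trans ?_
    rw [norm_pow, Circle.norm_coe, one_pow, norm_one]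
    norm_num
  set D := ‖∑ k ∈ Finset.range N, (z : ℂ) ^ k‖ with hD
  have hD0 : 0 ≤ D := norm_nonneg _
  have h3 : D * ‖θ‖ ≤ 1 / 2 := by
    have := mul_le_mul_of_nonneg_left h1 hD0
    linarith
  have h4 : (D * ‖θ‖) ^ 2 ≤ (1 / 2) ^ 2 := pow_le_pow_left₀ (by positivity) h3 2
  calc fejer N z * ‖θ‖ ^ 2 = (D * ‖θ‖) ^ 2 / (N : ℝ) := by
        rw [fejer, ← hD]
        ring
    _ ≤ (1 / 2) ^ 2 / (N : ℝ) := by gcongr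
    _ = 1 / (4 * N) := by
        rw [← div_div]
        norm_num

/-- The first moment of the kernel controls the error of averaging a Lipschitz element. The order `R
^ 2` balances the total mass against the pointwise bound `fejer_mul_norm_sq_le`. -/
theorem sum_fejer_mul_norm_le {M R : ℕ} (hR : R ≠ 0) (hRM : R ^ 2 ≤ M) :
    ∑ m ∈ Finset.range M, fejer (R ^ 2) (rationalPoint M m).toCircle * ‖rationalPoint M m‖ ≤
      M / R := by
  have hR' : (0 : ℝ) < R := by exact_mod_cast Nat.pos_of_ne_zero hR
  have hpt : ∀ m, fejer (R ^ 2) (rationalPoint M m).toCircle * ‖rationalPoint M m‖ ≤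
      fejer (R ^ 2) (rationalPoint M m).toCircle * (1 / (2 * R)) + 1 / (8 * R) := by
    intro m
    set θ := rationalPoint M m
    have h1 := fejer_mul_norm_sq_le (R ^ 2) θ
    have h0 := fejer_nonneg (R ^ 2) θ.toCircle
    set K := fejer (R ^ 2) θ.toCircle
    -- The arithmetic-geometric mean inequality trades the first moment for mass and second moment.
    have hsq : ‖θ‖ ≤ 1 / (2 * R) + R / 2 * ‖θ‖ ^ 2 := by
      have : 1 / (2 * R) + R / 2 * ‖θ‖ ^ 2 - ‖θ‖ = (R * ‖θ‖ - 1) ^ 2 / (2 * R) := by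
        field_simp
        ring
      have : 0 ≤ (R * ‖θ‖ - 1) ^ 2 / (2 * R) := by positivity
      linarith
    calc K * ‖θ‖ ≤ K * (1 / (2 * R) + R / 2 * ‖θ‖ ^ 2) := by gcongr
      _ = K * (1 / (2 * R)) + R / 2 * (K * ‖θ‖ ^ 2) := by ring
      _ ≤ K * (1 / (2 * R)) + R / 2 * (1 / (4 * (R ^ 2 : ℕ))) := by gcongr
      _ = K * (1 / (2 * R)) + 1 / (8 * R) := by
          push_cast
          field_simp
          ring
  calc ∑ m ∈ Finset.range M, fejer (R ^ 2) (rationalPoint M m).toCircle * ‖rationalPoint M m‖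
      ≤ ∑ m ∈ Finset.range M,
          (fejer (R ^ 2) (rationalPoint M m).toCircle * (1 / (2 * R)) + 1 / (8 * R)) :=
        Finset.sum_le_sum fun m _ => hpt m
    _ = M * (1 / (2 * R)) + M * (1 / (8 * R)) := by
        rw [Finset.sum_add_distrib, ← Finset.sum_mul, sum_fejer (pow_ne_zero 2 hR) hRM]
        simp
    _ ≤ M / R := by
        have : (M : ℝ) / R - (M * (1 / (2 * R)) + M * (1 / (8 * R))) = 3 / 8 * (M / R) := by
          field_simp
          ring
        have h2 : (0 : ℝ) ≤ 3 / 8 * (M / R) := by positivity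
        linarith

namespace NCTorus

variable {p : ℕ} (ρ : AntisymmBichar p)

/-! ### Approximation of Lipschitz elements by polynomials -/

theorem norm_γ_sub_le {a : NCTorus ρ} (ha : L ρ a < ⊤) (t : Fin p → UnitAddCircle) :
    ‖γ ρ t a - a‖ ≤ (L ρ a).toReal * length t := by
  by_cases ht : t = 0
  · subst ht
    -- `L` says nothing at `t = 0`; there the identity is checked on monomials and extended by
    -- density.
    have h0 : γ ρ 0 a = a := by
      have hc : Continuous fun x : NCTorus ρ => γ ρ 0 x - x :=
        ((StarAlgEquiv.isometry (γ ρ 0)).continuous).sub continuous_id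
      have hpoly : ∀ b ∈ polySpan (u ρ) Set.univ, γ ρ 0 b = b := by
        intro b hb
        induction hb using Submodule.span_induction with
        | zero => simp
        | add a b _ _ ha hb => rw [map_add, ha, hb]
        | smul c a _ ha => rw [map_smul, ha]
        | mem x hx =>
          obtain ⟨g, -, rfl⟩ := hx
          simp [γ_monomial]
      have hzero : ‖γ ρ 0 a - a‖ ≤ 0 := by
        refine le_of_forall_pos_lt_add fun ε hε => ?_
        obtain ⟨b, hb, hab⟩ := exists_polySpan_norm_sub_lt ρ a (half_pos hε)
        have : γ ρ 0 a - a = γ ρ 0 (a - b) - (a - b) := by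
          rw [map_sub, hpoly b hb]
          abel
        rw [this]
        refine (norm_sub_le _ _).trans_lt ?_
        rw [StarAlgEquiv.norm_map]
        linarith
      exact sub_eq_zero.1 (norm_le_zero_iff.1 hzero)
    rw [h0, sub_self, norm_zero]
    exact mul_nonneg ENNReal.toReal_nonneg
      (mul_nonneg (by positivity) (Real.sqrt_nonneg _))
  · have hpos : 0 < length t := by
      obtain ⟨j, hj⟩ := Function.ne_iff.1 ht
      refine mul_pos (by positivity) (Real.sqrt_pos.2 ?_)
      exact Finset.sum_pos' (fun i _ => by positivity)
        ⟨j, Finset.mem_univ j, pow_pos (norm_pos_iff.2 hj) 2⟩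
    have h1 : ENNReal.ofReal (‖γ ρ t a - a‖ / length t) ≤ L ρ a :=
      le_iSup₂ (f := fun (t : Fin p → UnitAddCircle) (_ : t ≠ 0) =>
        ENNReal.ofReal (‖γ ρ t a - a‖ / length t)) t ht
    rw [← div_le_iff₀ hpos]
    exact (ENNReal.ofReal_le_iff_le_toReal ha.ne).1 h1

theorem length_single (j : Fin p) (θ : UnitAddCircle) :
    length (Pi.single j θ) = 2 * Real.pi * ‖θ‖ := by
  rw [length, Finset.sum_eq_single j, Pi.single_eq_same, Real.sqrt_sq (norm_nonneg _)]
  · intro i _ hij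
    simp [Pi.single_eq_of_ne hij]
  · simp

theorem γ_single_monomial (j : Fin p) (θ : UnitAddCircle) (g : Fin p → ℤ) :
    γ ρ (Pi.single j θ) (monomialUnitary (u ρ) g) =
      (θ.toCircle : ℂ) ^ g j • (monomialUnitary (u ρ) g : NCTorus ρ) := by
  rw [γ_monomial, Finset.prod_eq_single j, Pi.single_eq_same, Circle.coe_zpow]
  · intro i _ hij
    simp [Pi.single_eq_of_ne hij]
  · simp

/-- The average of the action over the `j`-th coordinate circle against the Fejér kernel, sampled
at the `M`-th roots of unity. -/
def fejerAverage (N M : ℕ) (j : Fin p) : NCTorus ρ →ₗ[ℂ] NCTorus ρ :=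
  ∑ m ∈ Finset.range M, ((fejer N (rationalPoint M m).toCircle / M : ℝ) : ℂ) •
    (γ ρ (Pi.single j (rationalPoint M m)) : NCTorus ρ →ₐ[ℂ] NCTorus ρ).toLinearMap

theorem fejerAverage_apply (N M : ℕ) (j : Fin p) (a : NCTorus ρ) :
    fejerAverage ρ N M j a = ∑ m ∈ Finset.range M,
      ((fejer N (rationalPoint M m).toCircle / M : ℝ) : ℂ) •
        γ ρ (Pi.single j (rationalPoint M m)) a := by
  simp [fejerAverage, LinearMap.sum_apply]

theorem norm_fejerAverage_le {N M : ℕ} (hN : N ≠ 0) (hNM : N ≤ M) (j : Fin p) (a : NCTorus ρ) :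
    ‖fejerAverage ρ N M j a‖ ≤ ‖a‖ := by
  have hM : (M : ℝ) ≠ 0 := by
    have : M ≠ 0 := by omega
    exact_mod_cast this
  rw [fejerAverage_apply]
  calc _ ≤ ∑ m ∈ Finset.range M, fejer N (rationalPoint M m).toCircle / M * ‖a‖ := by
        refine (norm_sum_le _ _).trans (Finset.sum_le_sum fun m _ => ?_)
        rw [norm_smul, StarAlgEquiv.norm_map, Complex.norm_real, Real.norm_of_nonneg
          (div_nonneg (fejer_nonneg _ _) (Nat.cast_nonneg _))]
    _ = ‖a‖ := by
        rw [← Finset.sum_mul, ← Finset.sum_div, sum_fejer hN hNM, div_self hM, one_mul]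

theorem norm_fejerAverage_sub_le {R M : ℕ} (hR : R ≠ 0) (hRM : R ^ 2 ≤ M) (j : Fin p)
    {a : NCTorus ρ} (ha : L ρ a < ⊤) :
    ‖fejerAverage ρ (R ^ 2) M j a - a‖ ≤ 2 * Real.pi * (L ρ a).toReal / R := by
  have hM : (M : ℝ) ≠ 0 := by
    have : M ≠ 0 := by
      have := Nat.pos_of_ne_zero (pow_ne_zero 2 hR)
      omega
    exact_mod_cast this
  set w : ℕ → ℝ := fun m => fejer (R ^ 2) (rationalPoint M m).toCircle / M with hw
  have hsum : ∑ m ∈ Finset.range M, w m = 1 := by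
    rw [hw, ← Finset.sum_div, sum_fejer (pow_ne_zero 2 hR) hRM, div_self hM]
  have hsplit : fejerAverage ρ (R ^ 2) M j a - a = ∑ m ∈ Finset.range M,
      (w m : ℂ) • (γ ρ (Pi.single j (rationalPoint M m)) a - a) := by
    simp_rw [smul_sub]
    refine Eq.symm ((Finset.sum_sub_distrib _ _).trans ?_)
    rw [← Finset.sum_smul, ← Complex.ofReal_sum, hsum, Complex.ofReal_one, one_smul,
      fejerAverage_apply]
    rfl
  rw [hsplit]
  calc _ ≤ ∑ m ∈ Finset.range M, (2 * Real.pi * (L ρ a).toReal / M) *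
          (fejer (R ^ 2) (rationalPoint M m).toCircle * ‖rationalPoint M m‖) := by
        refine (norm_sum_le _ _).trans (Finset.sum_le_sum fun m _ => ?_)
        have h0 : 0 ≤ w m := div_nonneg (fejer_nonneg _ _) (Nat.cast_nonneg _)
        rw [norm_smul, Complex.norm_real, Real.norm_of_nonneg h0]
        refine (mul_le_mul_of_nonneg_left (norm_γ_sub_le ρ ha _) h0).trans_eq ?_
        rw [length_single, hw]
        ring
    _ ≤ 2 * Real.pi * (L ρ a).toReal / M * (M / R) := by
        rw [← Finset.mul_sum]
        refine mul_le_mul_of_nonneg_left (sum_fejer_mul_norm_le hR hRM) ?_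
        have : 0 ≤ (L ρ a).toReal := ENNReal.toReal_nonneg
        positivity
    _ = _ := by
        field_simp

theorem fejerAverage_monomial (N M : ℕ) (j : Fin p) (g : Fin p → ℤ) :
    fejerAverage ρ N M j (monomialUnitary (u ρ) g) =
      ((M : ℂ)⁻¹ * ∑ m ∈ Finset.range M, (fejer N (rationalPoint M m).toCircle : ℂ) *
        ((rationalPoint M m).toCircle : ℂ) ^ g j) • (monomialUnitary (u ρ) g : NCTorus ρ) := by
  rw [fejerAverage_apply, Finset.mul_sum, Finset.sum_smul]
  refine Finset.sum_congr rfl fun m _ => ?_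
  rw [γ_single_monomial, smul_smul]
  congr 1
  push_cast
  ring

/-- Compose the Fejér averages over the coordinates in `s`. Each is a contraction and diagonal on
monomials, so the errors simply add and the Lipschitz constant of an intermediate average is never
needed. -/
theorem exists_contraction_truncating {R M : ℕ} (hR : R ≠ 0) (hRM : R ^ 2 ≤ M)
    (s : Finset (Fin p)) :
    ∃ F : NCTorus ρ →ₗ[ℂ] NCTorus ρ, (∀ a, ‖F a‖ ≤ ‖a‖) ∧
      (∀ a, L ρ a < ⊤ → ‖F a - a‖ ≤ s.card * (2 * Real.pi * (L ρ a).toReal / R)) ∧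
      ∀ g : Fin p → ℤ, (∀ i, |g i| + (R ^ 2 : ℕ) ≤ M) →
        ∃ c : ℂ, F (monomialUnitary (u ρ) g) = c • (monomialUnitary (u ρ) g : NCTorus ρ) ∧
          ∀ i ∈ s, (R ^ 2 : ℕ) ≤ |g i| → c = 0 := by
  classical
  induction s using Finset.induction_on with
  | empty => exact ⟨LinearMap.id, by simp, by simp, fun g _ => ⟨1, by simp, by simp⟩⟩
  | insert j s hj ih =>
    obtain ⟨F, h1, h2, h3⟩ := ih
    refine ⟨fejerAverage ρ (R ^ 2) M j ∘ₗ F, fun a => ?_, fun a ha => ?_, fun g hg => ?_⟩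
    · exact (norm_fejerAverage_le ρ (pow_ne_zero 2 hR) hRM j _).trans (h1 a)
    · have e : (fejerAverage ρ (R ^ 2) M j ∘ₗ F) a - a =
          fejerAverage ρ (R ^ 2) M j (F a - a) + (fejerAverage ρ (R ^ 2) M j a - a) := by
        rw [map_sub, LinearMap.comp_apply]
        abel
      rw [e, Finset.card_insert_of_notMem hj]
      push_cast
      rw [add_mul, one_mul]
      exact (norm_add_le _ _).trans (add_le_add
        ((norm_fejerAverage_le ρ (pow_ne_zero 2 hR) hRM j _).trans (h2 a ha))
        (norm_fejerAverage_sub_le ρ hR hRM j ha))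
    · obtain ⟨c, hc, hc0⟩ := h3 g hg
      have hM : M ≠ 0 := by
        have := Nat.pos_of_ne_zero (pow_ne_zero 2 hR)
        omega
      refine ⟨c * ((M : ℂ)⁻¹ * ∑ m ∈ Finset.range M,
        (fejer (R ^ 2) (rationalPoint M m).toCircle : ℂ) *
          ((rationalPoint M m).toCircle : ℂ) ^ g j), ?_, ?_⟩
      · rw [LinearMap.comp_apply, hc, map_smul, fejerAverage_monomial, smul_smul]
      · intro i hi hgi
        rcases Finset.mem_insert.1 hi with rfl | hi
        · rw [sum_fejer_mul_zpow_eq_zero hM hgi (hg i), mul_zero, mul_zero]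
        · rw [hc0 i hi hgi, zero_mul]

/-- An arbitrary polynomial near `a` has uncontrolled degree; truncating it by a contraction that
moves `a` by `O(1/R)` brings the degree down to `R ^ 2`. -/
theorem exists_polySpan_box_approx {a : NCTorus ρ} (ha : L ρ a < ⊤) (ha1 : ‖a‖ ≤ 1) {R : ℕ}
    (hR : R ≠ 0) :
    ∃ y ∈ polySpan (u ρ) {g | ∀ i, |g i| ≤ (R ^ 2 : ℕ)}, ‖y‖ ≤ 1 ∧
      ‖a - y‖ ≤ 2 * (1 + p * (2 * Real.pi * (L ρ a).toReal)) / R := by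
  have hR' : (0 : ℝ) < R := by exact_mod_cast Nat.pos_of_ne_zero hR
  obtain ⟨b, hb, hab⟩ := exists_polySpan_norm_sub_lt ρ a (one_div_pos.2 hR')
  obtain ⟨M, hbM⟩ := exists_mem_polySpan_box (u ρ) hb
  -- With `M + R ^ 2` sample points, no exponent of `b` is aliased.
  obtain ⟨F, h1, h2, h3⟩ := exists_contraction_truncating ρ hR (Nat.le_add_left (R ^ 2) M)
    Finset.univ
  have hFb : F b ∈ polySpan (u ρ) {g | ∀ i, |g i| ≤ (R ^ 2 : ℕ)} := by
    refine map_mem_polySpan (u ρ) F (fun g hg => ?_) hbM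
    obtain ⟨c, hc, hc0⟩ := h3 g fun i => by
      have := hg i
      push_cast at this ⊢
      linarith
    rw [hc]
    by_cases h : ∀ i, |g i| ≤ (R ^ 2 : ℕ)
    · exact Submodule.smul_mem _ _ (monomial_mem_polySpan (u ρ) h)
    · obtain ⟨i, hi⟩ := not_forall.1 h
      rw [hc0 i (Finset.mem_univ i) (not_le.1 hi).le, zero_smul]
      exact zero_mem _
  set η : ℝ := (1 + p * (2 * Real.pi * (L ρ a).toReal)) / R with hη
  have hη0 : 0 ≤ η := by
    have : 0 ≤ (L ρ a).toReal := ENNReal.toReal_nonneg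
    positivity
  have hclose : ‖a - F b‖ ≤ η := by
    have e : a - F b = F (a - b) - (F a - a) := by
      rw [map_sub]
      abel
    rw [e]
    refine (norm_sub_le _ _).trans ?_
    have h4 := (h1 (a - b)).trans hab.le
    have h5 := h2 a ha
    rw [Finset.card_univ, Fintype.card_fin] at h5
    have : η = 1 / R + p * (2 * Real.pi * (L ρ a).toReal / R) := by
      rw [hη]
      ring
    linarith
  have hFb1 : ‖F b‖ ≤ 1 + η := by
    have : F b = a - (a - F b) := by abel
    rw [this]
    exact (norm_sub_le _ _).trans (add_le_add ha1 hclose)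
  have hpos : 0 < 1 + η := by linarith
  -- Rescaling into the unit ball costs another `η`, whence the factor `2` in the error.
  refine ⟨((1 + η : ℝ) : ℂ)⁻¹ • F b, Submodule.smul_mem _ _ hFb, ?_, ?_⟩
  · rw [norm_smul, norm_inv, Complex.norm_real, Real.norm_of_nonneg hpos.le]
    exact (inv_mul_le_one₀ hpos).2 hFb1
  · have e : a - ((1 + η : ℝ) : ℂ)⁻¹ • F b =
        (a - F b) + ((η / (1 + η) : ℝ) : ℂ) • F b := by
      have : ((η / (1 + η) : ℝ) : ℂ) = 1 - ((1 + η : ℝ) : ℂ)⁻¹ := by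
        have h : η / (1 + η) = 1 - (1 + η)⁻¹ := by
          field_simp
          ring
        rw [h]
        push_cast
        rfl
      rw [this, sub_smul, one_smul]
      abel
    rw [e]
    refine (norm_add_le _ _).trans ?_
    have h6 : ‖((η / (1 + η) : ℝ) : ℂ) • F b‖ ≤ η := by
      rw [norm_smul, Complex.norm_real, Real.norm_of_nonneg (by positivity)]
      calc η / (1 + η) * ‖F b‖ ≤ η / (1 + η) * (1 + η) := by gcongr
        _ = η := div_mul_cancel₀ _ hpos.ne'
    have : 2 * (1 + p * (2 * Real.pi * (L ρ a).toReal)) / R = η + η := by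
      rw [hη]
      ring
    linarith

end NCTorus

/-! ### Ordered products along an orbit -/

section OrderedProducts

variable {A : Type*} [CStarAlgebra A]

/-- The ordered product `f 0 * f 1 * ⋯ * f (n - 1)`. -/
def seqProd (f : ℕ → A) : ℕ → A
  | 0 => 1
  | n + 1 => seqProd f n * f n

theorem prod_ofFn_eq_seqProd (f : ℕ → A) (n : ℕ) :
    (List.ofFn fun j : Fin n => f j).prod = seqProd f n := by
  induction n with
  | zero => simp [seqProd]
  | succ n ih =>
    rw [List.ofFn_succ', List.concat_eq_append, List.prod_append, List.prod_singleton, seqProd, ← ih]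
    simp

theorem exists_eq_seqProd_of_mem_orbitProduct {α : A ≃⋆ₐ[ℂ] A} {Ω : Set A} {n : ℕ} {x : A}
    (hx : x ∈ orbitProduct α Ω n) :
    ∃ a : ℕ → A, (∀ k < n, a k ∈ Ω) ∧ x = seqProd (fun k => (α : A → A)^[k] (a k)) n := by
  obtain ⟨a, ha, rfl⟩ := hx
  refine ⟨fun k => if h : k < n then a ⟨k, h⟩ else 0, fun k hk => by simpa [hk] using ha ⟨k, hk⟩, ?_⟩
  rw [← prod_ofFn_eq_seqProd]
  congr 2
  funext j
  simp

theorem norm_iterate_starAlgEquiv (β : A ≃⋆ₐ[ℂ] A) (k : ℕ) (x : A) :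
    ‖(β : A → A)^[k] x‖ = ‖x‖ := by
  induction k with
  | zero => rfl
  | succ k ih => rw [Function.iterate_succ_apply', StarAlgEquiv.norm_map, ih]

theorem norm_seqProd_le_one {f : ℕ → A} {n : ℕ} (hf : ∀ k < n, ‖f k‖ ≤ 1) :
    ‖seqProd f n‖ ≤ 1 := by
  induction n with
  | zero =>
    rcases subsingleton_or_nontrivial A with h | h
    · rw [Subsingleton.elim (seqProd f 0) 0, norm_zero]
      exact zero_le_one
    · exact CStarRing.norm_one.le
  | succ n ih =>
    exact (norm_mul_le _ _).trans (mul_le_one₀ (ih fun k hk => hf k (hk.trans n.lt_succ_self))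
      (norm_nonneg _) (hf n n.lt_succ_self))

/-- Telescoping: replacing one factor at a time costs `η`, as all other factors are contractions. -/
theorem norm_seqProd_sub_le {f g : ℕ → A} {n : ℕ} {η : ℝ} (hf : ∀ k < n, ‖f k‖ ≤ 1)
    (hg : ∀ k < n, ‖g k‖ ≤ 1) (h : ∀ k < n, ‖f k - g k‖ ≤ η) :
    ‖seqProd f n - seqProd g n‖ ≤ n * η := by
  induction n with
  | zero => simp [seqProd]
  | succ n ih =>
    have hlt : ∀ k < n, k < n + 1 := fun k hk => hk.trans n.lt_succ_self
    have e : seqProd f (n + 1) - seqProd g (n + 1) =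
        (seqProd f n - seqProd g n) * f n + seqProd g n * (f n - g n) := by
      simp only [seqProd]
      noncomm_ring
    rw [e]
    have h1 := ih (fun k hk => hf k (hlt k hk)) (fun k hk => hg k (hlt k hk))
      (fun k hk => h k (hlt k hk))
    have h2 := norm_seqProd_le_one fun k hk => hg k (hlt k hk)
    have h3 := hf n n.lt_succ_self
    have h4 := h n n.lt_succ_self
    calc _ ≤ ‖seqProd f n - seqProd g n‖ * ‖f n‖ + ‖seqProd g n‖ * ‖f n - g n‖ :=
          (norm_add_le _ _).trans (add_le_add (norm_mul_le _ _) (norm_mul_le _ _))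
      _ ≤ ‖seqProd f n - seqProd g n‖ * 1 + 1 * ‖f n - g n‖ := by gcongr
      _ ≤ ((n + 1 : ℕ) : ℝ) * η := by
          push_cast
          linarith

theorem iterate_star (β : A ≃⋆ₐ[ℂ] A) (k : ℕ) (x : A) :
    (β : A → A)^[k] (star x) = star ((β : A → A)^[k] x) := by
  induction k generalizing x with
  | zero => rfl
  | succ k ih => rw [Function.iterate_succ_apply, map_star, ih, Function.iterate_succ_apply]

theorem star_seqProd_iterate_mul_self (β : A ≃⋆ₐ[ℂ] A) (u : unitary A) (n : ℕ) :
    star (seqProd (fun k => (β : A → A)^[k] u) n) * seqProd (fun k => (β : A → A)^[k] u) n = 1 := by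
  induction n with
  | zero => simp [seqProd]
  | succ n ih =>
    have : star ((β : A → A)^[n] u) * (β : A → A)^[n] u = 1 := by
      rw [← iterate_star, ← iterate_map_mul, Unitary.coe_star_mul_self, iterate_map_one]
    simp only [seqProd, star_mul]
    rw [mul_assoc, ← mul_assoc (star (seqProd _ n)), ih, one_mul, this]

theorem norm_star_seqProd_iterate_le (β : A ≃⋆ₐ[ℂ] A) (u : unitary A) (n : ℕ) :
    ‖star (seqProd (fun k => (β : A → A)^[k] u) n)‖ ≤ 1 := by
  rw [norm_star]
  refine norm_seqProd_le_one fun k _ => ?_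
  rw [norm_iterate_starAlgEquiv]
  rcases subsingleton_or_nontrivial A with h | h
  · rw [Subsingleton.elim (u : A) 0, norm_zero]
    exact zero_le_one
  · exact (CStarRing.norm_coe_unitary u).le

theorem iterate_trans_conj (β : A ≃⋆ₐ[ℂ] A) (u : unitary A) (n : ℕ) (x : A) :
    (β.trans (Unitary.conjStarAlgAut ℂ A u) : A → A)^[n] x =
      seqProd (fun k => (β : A → A)^[k] u) n * (β : A → A)^[n] x *
        star (seqProd (fun k => (β : A → A)^[k] u) n) := by
  induction n generalizing x with
  | zero => simp [seqProd]
  | succ n ih =>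
    rw [Function.iterate_succ_apply, ih, StarAlgEquiv.trans_apply, Unitary.conjStarAlgAut_apply,
      iterate_map_mul, iterate_map_mul, iterate_star, ← Function.iterate_succ_apply]
    simp only [seqProd, star_mul, mul_assoc]

/-- With `W_n = u β(u) ⋯ β^{n-1}(u)`, the `n`-th iterate is `W_n β^n(·) W_n*`. Between consecutive
factors `W_n* W_{n+1}` collapses to `β^n(u)`, and only the last adjoint remains. -/
theorem seqProd_iterate_trans_conj (β : A ≃⋆ₐ[ℂ] A) (u : unitary A) (a : ℕ → A) (n : ℕ) :
    seqProd (fun k => (β.trans (Unitary.conjStarAlgAut ℂ A u) : A → A)^[k] (a k)) n =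
      seqProd (fun k => (β : A → A)^[k] (a k * u)) n *
        star (seqProd (fun k => (β : A → A)^[k] u) n) := by
  induction n with
  | zero => simp [seqProd]
  | succ n ih =>
    have hW := star_seqProd_iterate_mul_self β u n
    have hu : (β : A → A)^[n] u * star ((β : A → A)^[n] u) = 1 := by
      rw [← iterate_star, ← iterate_map_mul, Unitary.mul_star_self_of_mem u.2, iterate_map_one]
    have h1 : seqProd (fun k => (β.trans (Unitary.conjStarAlgAut ℂ A u) : A → A)^[k] (a k)) (n + 1) =
        seqProd (fun k => (β : A → A)^[k] (a k * u)) n *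
          ((star (seqProd (fun k => (β : A → A)^[k] u) n) *
            seqProd (fun k => (β : A → A)^[k] u) n) * (β : A → A)^[n] (a n)) *
          star (seqProd (fun k => (β : A → A)^[k] u) n) := by
      rw [seqProd, ih, iterate_trans_conj]
      simp only [mul_assoc]
    have h2 : seqProd (fun k => (β : A → A)^[k] (a k * u)) (n + 1) *
          star (seqProd (fun k => (β : A → A)^[k] u) (n + 1)) =
        seqProd (fun k => (β : A → A)^[k] (a k * u)) n * ((β : A → A)^[n] (a n) *
          ((β : A → A)^[n] u * star ((β : A → A)^[n] u))) *
          star (seqProd (fun k => (β : A → A)^[k] u) n) := by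
      rw [seqProd, iterate_map_mul]
      simp only [seqProd, star_mul, mul_assoc]
    rw [h1, h2, hW, hu, one_mul, mul_one]

theorem approxDim_le {Z : Set A} {δ : ℝ} (X : Submodule ℂ A) (hX : FiniteDimensional ℂ X)
    (h : ApproxContains (X : Set A) Z δ) : approxDim Z δ ≤ (Module.finrank ℂ X : ℕ∞) :=
  iInf_le_of_le X (iInf_le_of_le hX (iInf_le_of_le h le_rfl))

variable {p : ℕ}

theorem iterate_mem_polySpan {v : Fin p → unitary A} (β : A ≃⋆ₐ[ℂ] A)
    (T : Matrix (Fin p) (Fin p) ℤ)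
    (hβ : ∀ g, ∃ c : ℂ, β (monomialUnitary v g) = c • (monomialUnitary v (T.mulVec g) : A))
    {S : Set (Fin p → ℤ)} (k : ℕ) {x : A} (hx : x ∈ polySpan v S) :
    (β : A → A)^[k] x ∈ polySpan v ((T ^ k).mulVec '' S) := by
  induction k with
  | zero =>
    refine polySpan_mono v ?_ hx
    intro g hg
    exact ⟨g, hg, by simp⟩
  | succ k ih =>
    rw [Function.iterate_succ_apply']
    refine map_mem_polySpan v (β : A →ₐ[ℂ] A).toLinearMap ?_ ih
    rintro _ ⟨g, hg, rfl⟩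
    obtain ⟨c, hc⟩ := hβ ((T ^ k).mulVec g)
    change β _ ∈ _
    rw [hc]
    refine Submodule.smul_mem _ _ (monomial_mem_polySpan v ⟨g, hg, ?_⟩)
    rw [Matrix.mulVec_mulVec, pow_succ']

theorem PhaseCommuting.seqProd_mem_polySpan {v : Fin p → unitary A} (hv : PhaseCommuting v)
    (β : A ≃⋆ₐ[ℂ] A) (T : Matrix (Fin p) (Fin p) ℤ)
    (hβ : ∀ g, ∃ c : ℂ, β (monomialUnitary v g) = c • (monomialUnitary v (T.mulVec g) : A))
    (N n : ℕ) (y : ℕ → A) (hy : ∀ k < n, y k ∈ polySpan v {g | ∀ i, |g i| ≤ N}) :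
    seqProd (fun k => (β : A → A)^[k] (y k)) n ∈ polySpan v (orbitSumset T N n) := by
  induction n with
  | zero =>
    have := monomial_mem_polySpan v (S := orbitSumset T N 0) (g := 0) ⟨0, by simp, by simp⟩
    rwa [monomialUnitary_zero] at this
  | succ n ih =>
    refine hv.mul_mem_polySpan ?_ (ih fun k hk => hy k (hk.trans n.lt_succ_self))
      (iterate_mem_polySpan β T hβ n (hy n n.lt_succ_self))
    rintro _ ⟨z, hz, rfl⟩ _ ⟨g, hg, rfl⟩
    refine ⟨Function.update z n g, fun k => ?_, ?_⟩
    · by_cases h : k = n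
      · subst h
        rw [Function.update_self]
        exact hg
      · rw [Function.update_of_ne h]
        exact hz k
    · rw [Finset.sum_range_succ, Function.update_self]
      congr 1
      refine Finset.sum_congr rfl fun k hk => ?_
      rw [Function.update_of_ne (Finset.mem_range.1 hk).ne]

theorem PhaseCommuting.approxDim_orbitProduct_le {v : Fin p → unitary A} (hv : PhaseCommuting v)
    (β : A ≃⋆ₐ[ℂ] A) (T : Matrix (Fin p) (Fin p) ℤ)
    (hβ : ∀ g, ∃ c : ℂ, β (monomialUnitary v g) = c • (monomialUnitary v (T.mulVec g) : A))
    (u : unitary A) {Ω : Set A} {N n : ℕ} {η δ : ℝ} (hΩ1 : ∀ a ∈ Ω, ‖a‖ ≤ 1)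
    (hΩ : ∀ a ∈ Ω, ∃ y ∈ polySpan v {g | ∀ i, |g i| ≤ N}, ‖y‖ ≤ 1 ∧ ‖a * u - y‖ ≤ η)
    (hη : n * η < δ) (hfin : (orbitSumset T N n).Finite) :
    approxDim (orbitProduct (β.trans (Unitary.conjStarAlgAut ℂ A u)) Ω n) δ ≤
      ((orbitSumset T N n).ncard : ℕ∞) := by
  set W := star (seqProd (fun k => (β : A → A)^[k] u) n) with hW
  have hfd := finiteDimensional_polySpan v hfin
  -- `W` does not depend on the chosen elements of `Ω`, so one subspace serves all products.
  refine (approxDim_le ((polySpan v (orbitSumset T N n)).map (LinearMap.mulRight ℂ W))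
    inferInstance ?_).trans ?_
  · intro x hx
    obtain ⟨a, ha, rfl⟩ := exists_eq_seqProd_of_mem_orbitProduct hx
    have hch : ∀ k, ∃ y, k < n →
        y ∈ polySpan v {g | ∀ i, |g i| ≤ N} ∧ ‖y‖ ≤ 1 ∧ ‖a k * u - y‖ ≤ η := by
      intro k
      by_cases hk : k < n
      · obtain ⟨y, h1, h2, h3⟩ := hΩ _ (ha k hk)
        exact ⟨y, fun _ => ⟨h1, h2, h3⟩⟩
      · exact ⟨0, fun h => absurd h hk⟩
    choose y hy using hch
    refine ⟨seqProd (fun k => (β : A → A)^[k] (y k)) n * W, ⟨_, hv.seqProd_mem_polySpan β T hβ N n y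
      (fun k hk => (hy k hk).1), rfl⟩, ?_⟩
    rw [seqProd_iterate_trans_conj, ← sub_mul]
    have hbound : ‖seqProd (fun k => (β : A → A)^[k] (a k * u)) n -
        seqProd (fun k => (β : A → A)^[k] (y k)) n‖ ≤ n * η := by
      refine norm_seqProd_sub_le (fun k hk => ?_) (fun k hk => ?_) (fun k hk => ?_)
      · rw [norm_iterate_starAlgEquiv, CStarRing.norm_mul_coe_unitary]
        exact hΩ1 _ (ha k hk)
      · rw [norm_iterate_starAlgEquiv]
        exact (hy k hk).2.1
      · rw [← iterate_map_sub, norm_iterate_starAlgEquiv]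
        exact (hy k hk).2.2
    calc _ ≤ ‖seqProd (fun k => (β : A → A)^[k] (a k * u)) n -
            seqProd (fun k => (β : A → A)^[k] (y k)) n‖ * ‖W‖ := norm_mul_le _ _
      _ ≤ ‖seqProd (fun k => (β : A → A)^[k] (a k * u)) n -
            seqProd (fun k => (β : A → A)^[k] (y k)) n‖ * 1 := by
          gcongr
          exact norm_star_seqProd_iterate_le β u n
      _ < δ := by
          rw [mul_one]
          exact hbound.trans_lt hη
  · exact_mod_cast (Submodule.finrank_map_le _ _).trans (finrank_polySpan_le v hfin)

end OrderedProducts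

/-! ### Exponential growth rates. -/

theorem tendsto_log_mul_pow_div {C Λ : ℝ} (hC : 0 < C) (hΛ : 0 < Λ) (q : ℕ) :
    Filter.Tendsto (fun n : ℕ => (n : ℝ)⁻¹ * Real.log (C * (n : ℝ) ^ q * Λ ^ n)) Filter.atTop
      (nhds (Real.log Λ)) := by
  have h1 : Filter.Tendsto (fun n : ℕ => Real.log C * (n : ℝ)⁻¹) Filter.atTop (nhds 0) := by
    simpa using (tendsto_inv_atTop_nhds_zero_nat (𝕜 := ℝ)).const_mul (Real.log C)
  have h2 : Filter.Tendsto (fun n : ℕ => q * (Real.log n / (n : ℝ))) Filter.atTop (nhds 0) := by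
    have := (Real.isLittleO_log_id_atTop.tendsto_div_nhds_zero.comp
      tendsto_natCast_atTop_atTop).const_mul (q : ℝ)
    rw [mul_zero] at this
    exact this
  have h3 := (h1.add h2).add_const (Real.log Λ)
  rw [zero_add, zero_add] at h3
  refine h3.congr' ?_
  filter_upwards [Filter.eventually_ge_atTop 1] with n hn
  have hn' : (0 : ℝ) < n := by exact_mod_cast hn
  rw [Real.log_mul (by positivity) (by positivity), Real.log_mul hC.ne' (by positivity),
    Real.log_pow, Real.log_pow]
  field_simp

theorem limsup_log_le {D : ℕ → ℕ∞} {C Λ : ℝ} (hC : 0 < C) (hΛ : 0 < Λ) (q : ℕ)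
    (h : ∀ n : ℕ, 1 ≤ n → ∃ m : ℕ, D n ≤ m ∧ (m : ℝ) ≤ C * (n : ℝ) ^ q * Λ ^ n) :
    Filter.limsup (fun n : ℕ => (((n : ℝ)⁻¹ : ℝ) : EReal) *
      ENNReal.log ((D n : ℕ∞) : ℝ≥0∞)) Filter.atTop ≤ ((Real.log Λ : ℝ) : EReal) := by
  have hlim := (continuous_coe_real_ereal.tendsto _).comp (tendsto_log_mul_pow_div hC hΛ q)
  rw [← hlim.limsup_eq]
  refine Filter.limsup_le_limsup ?_
  filter_upwards [Filter.eventually_ge_atTop 1] with n hn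
  obtain ⟨m, hDm, hm⟩ := h n hn
  have hn' : (0 : ℝ) < n := by exact_mod_cast hn
  have hle : ((D n : ℕ∞) : ℝ≥0∞) ≤ ENNReal.ofReal (C * (n : ℝ) ^ q * Λ ^ n) := by
    have h1 : ((D n : ℕ∞) : ℝ≥0∞) ≤ ((m : ℕ∞) : ℝ≥0∞) := ENat.toENNReal_le.2 hDm
    refine h1.trans ?_
    rw [ENat.toENNReal_coe, ← ENNReal.ofReal_natCast]
    exact ENNReal.ofReal_le_ofReal hm
  rw [Function.comp_apply, EReal.coe_mul]
  refine mul_le_mul_of_nonneg_left ?_ (EReal.coe_nonneg.2 (inv_nonneg.2 hn'.le))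
  rw [← ENNReal.log_ofReal_of_pos (by positivity)]
  exact ENNReal.log_monotone hle

/-! ### Products of Lipschitz elements and the entropy bound. -/

namespace NCTorus

variable {p : ℕ} (ρ : AntisymmBichar p)

/-- The Leibniz inequality; it is needed for the elements `a * u`. -/
theorem L_mul_lt_top {a b : NCTorus ρ} (ha : L ρ a < ⊤) (hb : L ρ b < ⊤) : L ρ (a * b) < ⊤ := by
  refine lt_of_le_of_lt (b := ENNReal.ofReal ((L ρ a).toReal * ‖b‖ + ‖a‖ * (L ρ b).toReal))
    (iSup₂_le fun t ht => ENNReal.ofReal_le_ofReal ?_) ENNReal.ofReal_lt_top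
  have hlen : 0 ≤ length t := mul_nonneg (by positivity) (Real.sqrt_nonneg _)
  refine div_le_of_le_mul₀ hlen (add_nonneg (mul_nonneg ENNReal.toReal_nonneg (norm_nonneg _))
    (mul_nonneg (norm_nonneg _) ENNReal.toReal_nonneg)) ?_
  have e : γ ρ t (a * b) - a * b = (γ ρ t a - a) * γ ρ t b + a * (γ ρ t b - b) := by
    rw [map_mul]
    noncomm_ring
  calc ‖γ ρ t (a * b) - a * b‖ ≤ ‖γ ρ t a - a‖ * ‖γ ρ t b‖ + ‖a‖ * ‖γ ρ t b - b‖ := by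
        rw [e]
        exact (norm_add_le _ _).trans (add_le_add (norm_mul_le _ _) (norm_mul_le _ _))
    _ ≤ (L ρ a).toReal * length t * ‖b‖ + ‖a‖ * ((L ρ b).toReal * length t) := by
        rw [StarAlgEquiv.norm_map]
        gcongr
        · exact norm_γ_sub_le ρ ha t
        · exact norm_γ_sub_le ρ hb t
    _ = _ := by ring

end NCTorus

end

theorem mainTheorem2 {p : ℕ} (ρ : AntisymmBichar p)
    (T : Matrix (Fin p) (Fin p) ℤ) (hT : T.det = 1 ∨ T.det = -1)
    (αT : NCTorus ρ ≃⋆ₐ[ℂ] NCTorus ρ)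
    (hαT : ∀ j, αT (NCTorus.u ρ j) =
      (((List.ofFn fun i => NCTorus.u ρ i ^ T i j).prod : unitary (NCTorus ρ)) : NCTorus ρ))
    (t : Fin p → UnitAddCircle)
    (u : unitary (NCTorus ρ)) (hu : NCTorus.L ρ (u : NCTorus ρ) < ⊤) :
    productEntropy (NCTorus.L ρ) (((NCTorus.γ ρ t).trans αT).trans
        (Unitary.conjStarAlgAut ℂ (NCTorus ρ) u)) ≤
      ((sumLogEigenvalues T : ℝ) : EReal) := by
  have hβ : ∀ g, ∃ c : ℂ, ((NCTorus.γ ρ t).trans αT) (monomialUnitary (NCTorus.u ρ) g) =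
      c • (monomialUnitary (NCTorus.u ρ) (T.mulVec g) : NCTorus ρ) := by
    intro g
    obtain ⟨z, hz⟩ := (NCTorus.phaseCommuting_u ρ).map_monomial
      (αT : NCTorus ρ →⋆ₐ[ℂ] NCTorus ρ) T (fun j => ⟨1, by
        rw [Circle.coe_one, one_smul]
        exact hαT j⟩) g
    refine ⟨((∏ i, (t i).toCircle ^ g i : Circle) : ℂ) * z, ?_⟩
    rw [StarAlgEquiv.trans_apply, NCTorus.γ_monomial, map_smul, mul_smul]
    exact congrArg _ hz
  obtain ⟨C, q, hC, hcount⟩ := exists_ncard_orbitSumset_le T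
  refine iSup_le fun Ω => iSup_le fun hΩ => iSup_le fun δ => iSup_le fun hδ => ?_
  let κ : NCTorus ρ → ℝ := fun a => 2 * (1 + p * (2 * Real.pi * (NCTorus.L ρ (a * u)).toReal))
  have hκ0 : ∀ a, 0 ≤ κ a := fun a => by
    have : 0 ≤ (NCTorus.L ρ (a * u)).toReal := ENNReal.toReal_nonneg
    positivity
  -- With `R = Q * n`, each factor has error at most `∑ κ / (Q n)`, so `n` factors have total error
  -- at most `∑ κ / Q < δ`.
  obtain ⟨Q, hQ⟩ := exists_nat_gt ((∑ a ∈ Ω, κ a) / δ)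
  have hQpos : (0 : ℝ) < Q := lt_of_le_of_lt (div_nonneg (Finset.sum_nonneg fun a _ => hκ0 a) hδ.le) hQ
  rw [div_lt_iff₀ hδ] at hQ
  have hQ0 : Q ≠ 0 := by
    rintro rfl
    simp at hQpos
  rw [← log_expansionRate]
  -- The box radius is `(Q n)^2`, so the polynomial factor is `((Q n)^2 n)^q = Q^(2q) n^(3q)`.
  refine limsup_log_le (C := C * (Q : ℝ) ^ (2 * q)) (q := 3 * q) (by positivity)
    (expansionRate_pos T) fun n hn => ?_
  have hn' : (0 : ℝ) < n := by exact_mod_cast hn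
  have hR : Q * n ≠ 0 := mul_ne_zero hQ0 (by omega)
  obtain ⟨hfin, hcard⟩ := hcount ((Q * n) ^ 2) n (Nat.one_le_iff_ne_zero.2 (pow_ne_zero 2 hR)) hn
  refine ⟨_, (NCTorus.phaseCommuting_u ρ).approxDim_orbitProduct_le _ T hβ u
    (N := (Q * n) ^ 2) (η := (∑ a ∈ Ω, κ a) / ((Q * n : ℕ) : ℝ))
    (fun a ha => (hΩ a ha).2) (fun a ha => ?_) ?_ hfin, hcard.trans_eq ?_⟩
  · obtain ⟨y, hy, hy1, hay⟩ := NCTorus.exists_polySpan_box_approx ρ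
      (NCTorus.L_mul_lt_top ρ (hΩ a ha).1 hu)
      (by rw [CStarRing.norm_mul_coe_unitary]; exact (hΩ a ha).2) hR
    refine ⟨y, hy, hy1, hay.trans ?_⟩
    refine div_le_div_of_nonneg_right ?_ (Nat.cast_nonneg _)
    exact Finset.single_le_sum (f := κ) (fun a _ => hκ0 a) ha
  · push_cast
    have : (n : ℝ) * ((∑ a ∈ Ω, κ a) / (Q * n)) = (∑ a ∈ Ω, κ a) / Q := by
      field_simp
    rw [this, div_lt_iff₀ hQpos]
    linarith
  · push_cast
    rw [show 3 * q = 2 * q + q by ring, pow_add, mul_pow, mul_pow, pow_mul, pow_mul]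
    ring
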